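/- Conventions. A complex affine algebraic supergroup $G$ is given by its coordinate superalgebra ${\mathbb C}[G]$, a finitely generated supercommutative Hopf superalgebra over ${\mathbb C}$; its underlying even algebraic group $G_0$ has coordinate ring ${\mathbb C}[G]/({\mathbb C}[G]_{\bar 1})$. $G$ is quasireductive if $G_0$ is linearly reductive (equivalently, its identity component is reductive); $G$ need not be connected. A $G$-module is a ${\mathbb Z}/2$-graded ${\mathbb C}[G]$-comodule, morphisms of $G$-modules are the even (parity-preserving) $G$-equivariant maps, and $\operatorname{Rep}G$ is the category of finite-dimensional $G$-modules. Write $\operatorname{sdim}M=\dim M_{\bar 0}-\dim M_{\bar 1}$, and $\operatorname{str}$ for the supertrace. A morphism $f:M\to N$ of $\operatorname{Rep}G$ is negligible if $\operatorname{str}(gf)=0$ for all $g:N\to M$; the semisimplification $\overline{\operatorname{Rep}G}$ is the quotient of $\operatorname{Rep}G$ by the ideal of negligible morphisms, with quotient functor $S_G:\operatorname{Rep}G\to\overline{\operatorname{Rep}G}$. Let $K\subseteq G$ be a closed subgroup. Then $\operatorname{Ind}_K^G{\mathbb C}={\mathbb C}[G/K]$ is the $G$-module of functions $f$ on $G$ with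 $f(kg)=f(g)$, on which $G$ acts by right translation. Call $K$ a splitting subgroup of $G$ if $K$ is quasireductive and the natural $G$-map ${\mathbb C}\to\operatorname{Ind}_K^G{\mathbb C}$ (the inclusion of the constants) has a $G$-equivariant left inverse. Let ${\mathfrak k}$ be the Lie superalgebra of $K$. An element $x\in{\mathfrak k}_{\bar 1}$ is homological if $[x,x]$ is a semisimple element of ${\mathfrak k}_{\bar 0}$; for such $x$ and a $K$-module $M$ put $DS_xM=\operatorname{Ker}(x|_M)/(\operatorname{Im}(x|_M)\cap\operatorname{Ker}(x|_M))$, a super vector space. The pair $(G,K)$ is proper if $G$ is quasireductive, $K$ is a splitting subgroup of $G$, and for some homological $x\in{\mathfrak k}_{\bar 1}$ we have $DS_x\operatorname{Ind}_K^G{\mathbb C}\cong{\mathbb C}$ as super vector spaces (with ${\mathbb C}$ purely even). Theorem. Let $(G,K)$ be a proper pair. Then there is exactly one functor $F:\overline{\operatorname{Rep}G}\to\overline{\operatorname{Rep}K}$ with $F\circ S_G=S_K\circ\operatorname{Res}^G_K$, and $F$ is full. In terms of modules: for every indecomposable $M\in\operatorname{Rep}G$ with $\operatorname{sdim}M\neq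 0$, the restriction $\operatorname{Res}^G_KM$ has exactly one indecomposable direct summand $\Phi(M)$ of nonzero superdimension. That is, such a summand exists, it is unique up to isomorphism, and if $\operatorname{Res}^G_KM\cong V\oplus W$ with $V$ indecomposable and $\operatorname{sdim}V\neq 0$, then $W$ has no indecomposable direct summand of nonzero superdimension. Moreover $M\mapsto\Phi(M)$ induces an injective map from the isomorphism classes of indecomposable modules of nonzero superdimension in $\operatorname{Rep}G$ to those in $\operatorname{Rep}K$. -/

import Mathlib

open CategoryTheory TensorProduct

noncomputable section

/-! ### Super vector spaces

A complex super vector space is a complex vector space `V` with a decomposition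
`V = 𝒱 0 ⊕ 𝒱 1` indexed by `ZMod 2`. -/

section SuperSpace

variable {V W : Type*} [AddCommGroup V] [Module ℂ V] [AddCommGroup W] [Module ℂ W]

/-- The homogeneous projection of a super vector space onto its part of parity `i`. -/
def superProj (𝒱 : ZMod 2 → Submodule ℂ V) [DirectSum.Decomposition 𝒱] (i : ZMod 2) :
    V →ₗ[ℂ] V :=
  (𝒱 i).subtype ∘ₗ DirectSum.component ℂ (ZMod 2) (fun j => 𝒱 j) i ∘ₗ
    (DirectSum.decomposeLinearEquiv 𝒱).toLinearMap

/-- The parity involution `v ↦ (-1)^{|v|} v` of a super vector space. -/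
def parityMap (𝒱 : ZMod 2 → Submodule ℂ V) [DirectSum.Decomposition 𝒱] : V →ₗ[ℂ] V :=
  superProj 𝒱 0 - superProj 𝒱 1

/-- The part of parity `i` of the tensor product of two super vector spaces: it is
`⨁_j V_j ⊗ W_{i-j}`. -/
def tensorPart (𝒱 : ZMod 2 → Submodule ℂ V) (𝒲 : ZMod 2 → Submodule ℂ W) (i : ZMod 2) :
    Submodule ℂ (V ⊗[ℂ] W) :=
  ⨆ j : ZMod 2, Submodule.map₂ (TensorProduct.mk ℂ V W) (𝒱 j) (𝒲 (i - j))

/-- The supertrace of an endomorphism of a finite-dimensional super vector space, the trace of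
`v ↦ (-1)^{|v|} f v`; for even `f` it is `tr (f | V_0) - tr (f | V_1)`. -/
def superTrace (𝒱 : ZMod 2 → Submodule ℂ V) [DirectSum.Decomposition 𝒱] (f : V →ₗ[ℂ] V) : ℂ :=
  LinearMap.trace ℂ V (parityMap 𝒱 ∘ₗ f)

/-- The grading of a vector space that is purely even. -/
def purelyEven (V : Type*) [AddCommGroup V] [Module ℂ V] (i : ZMod 2) : Submodule ℂ V :=
  if i = 0 then ⊤ else ⊥

lemma zmod_two_cases (i : ZMod 2) : i = 0 ∨ i = 1 := by revert i; decide

/-- Two complementary subspaces, one for each parity, make a super vector space. -/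
@[reducible]
def decompositionOfIsCompl (𝒱 : ZMod 2 → Submodule ℂ V) (h : IsCompl (𝒱 0) (𝒱 1)) :
    DirectSum.Decomposition 𝒱 :=
  ((DirectSum.isInternal_submodule_iff_isCompl 𝒱 (i := 0) (j := 1) (by decide)
    (by ext i; rcases zmod_two_cases i with rfl | rfl <;> simp)).2 h).chooseDecomposition

instance : DirectSum.Decomposition (purelyEven V) :=
  decompositionOfIsCompl _ (by simpa [purelyEven] using isCompl_top_bot)

/-- The sign `(-1)^i`, as a complex number. -/
def superSign (i : ZMod 2) : ℂ := if i = 0 then 1 else -1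

lemma tmul_mem_tensorPart (𝒱 : ZMod 2 → Submodule ℂ V) (𝒲 : ZMod 2 → Submodule ℂ W)
    {i j k : ZMod 2} {v : V} {w : W} (hv : v ∈ 𝒱 j) (hw : w ∈ 𝒲 k)
    (h : j + k = i) : v ⊗ₜ[ℂ] w ∈ tensorPart 𝒱 𝒲 i := by
  subst h
  refine Submodule.mem_iSup_of_mem j (Submodule.apply_mem_map₂ _ hv ?_)
  simpa using hw

section
variable (𝒱 : ZMod 2 → Submodule ℂ V) [DirectSum.Decomposition 𝒱]
  (𝒲 : ZMod 2 → Submodule ℂ W) [DirectSum.Decomposition 𝒲]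

lemma superProj_mem (i : ZMod 2) (v : V) : superProj 𝒱 i v ∈ 𝒱 i := by
  simp only [superProj, LinearMap.comp_apply, Submodule.subtype_apply]
  exact Subtype.property _

lemma superProj_of_mem {i : ZMod 2} (j : ZMod 2) {v : V} (hv : v ∈ 𝒱 i) :
    superProj 𝒱 j v = if i = j then v else 0 := by
  lift v to 𝒱 i using hv
  change ((DirectSum.decompose 𝒱 (v : V)) j : V) = _
  rw [DirectSum.decompose_coe]
  split_ifs with h
  · subst h; simp
  · rw [DirectSum.of_eq_of_ne _ _ _ (Ne.symm h)]; rfl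

lemma superProj_add (v : V) : superProj 𝒱 0 v + superProj 𝒱 1 v = v := by
  induction v using DirectSum.Decomposition.inductionOn 𝒱 with
  | zero => simp
  | @homogeneous i m =>
    rw [superProj_of_mem 𝒱 0 m.2, superProj_of_mem 𝒱 1 m.2]
    rcases zmod_two_cases i with rfl | rfl <;> simp
  | add x y hx hy =>
    rw [map_add, map_add]
    nth_rewrite 3 [← hx]
    nth_rewrite 3 [← hy]
    abel

lemma superSign_zero : superSign 0 = 1 := by simp [superSign]

lemma superSign_one : superSign 1 = -1 := by simp [superSign]

lemma parityMap_of_mem {i : ZMod 2} {v : V} (hv : v ∈ 𝒱 i) :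
    parityMap 𝒱 v = superSign i • v := by
  simp only [parityMap, LinearMap.sub_apply, superProj_of_mem 𝒱 _ hv]
  rcases zmod_two_cases i with rfl | rfl <;> simp [superSign_zero, superSign_one]

lemma mem_of_parityMap {i : ZMod 2} {v : V} (hv : parityMap 𝒱 v = superSign i • v) :
    v ∈ 𝒱 i := by
  have h := superProj_add 𝒱 v
  have h0 := superProj_mem 𝒱 0 v
  have h1 := superProj_mem 𝒱 1 v
  simp only [parityMap, LinearMap.sub_apply] at hv
  have h2 : (2 : ℂ) • v ∈ 𝒱 i := by
    rcases zmod_two_cases i with rfl | rfl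
    · rw [superSign_zero, one_smul] at hv
      have : (2 : ℂ) • v = (2 : ℂ) • superProj 𝒱 0 v := by
        linear_combination (norm := module) -h - hv
      rw [this]
      exact Submodule.smul_mem _ _ h0
    · rw [superSign_one, neg_smul, one_smul] at hv
      have : (2 : ℂ) • v = (2 : ℂ) • superProj 𝒱 1 v := by
        linear_combination (norm := module) -h + hv
      rw [this]
      exact Submodule.smul_mem _ _ h1
  exact (Submodule.smul_mem_iff _ two_ne_zero).1 h2

lemma superSign_mul (i j : ZMod 2) : superSign i * superSign j = superSign (i + j) := by
  rcases zmod_two_cases i with rfl | rfl <;> rcases zmod_two_cases j with rfl | rfl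
  · simp [superSign_zero]
  · simp [superSign_zero]
  · simp [superSign_zero]
  · rw [show (1 + 1 : ZMod 2) = 0 from by decide]; simp [superSign_zero, superSign_one]

/-- Parity-preserving maps commute with the parity involutions. -/
lemma parityMap_comm (f : V →ₗ[ℂ] W) (hf : ∀ i, ∀ v ∈ 𝒱 i, f v ∈ 𝒲 i) (v : V) :
    parityMap 𝒲 (f v) = f (parityMap 𝒱 v) := by
  have key : ∀ i, ∀ v ∈ 𝒱 i, parityMap 𝒲 (f v) = f (parityMap 𝒱 v) := fun i v hv => by
    rw [parityMap_of_mem 𝒱 hv, parityMap_of_mem 𝒲 (hf i v hv), map_smul]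
  rw [← superProj_add 𝒱 v]
  simp only [map_add, key 0 _ (superProj_mem 𝒱 0 v), key 1 _ (superProj_mem 𝒱 1 v)]

lemma map_parityMap_of_mem {i : ZMod 2} {t : V ⊗[ℂ] W} (ht : t ∈ tensorPart 𝒱 𝒲 i) :
    TensorProduct.map (parityMap 𝒱) (parityMap 𝒲) t = superSign i • t := by
  have : tensorPart 𝒱 𝒲 i ≤ LinearMap.ker (TensorProduct.map (parityMap 𝒱) (parityMap 𝒲) -
      superSign i • LinearMap.id) := by
    refine iSup_le fun j => Submodule.map₂_le.2 fun v hv w hw => ?_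
    simp only [TensorProduct.mk_apply, LinearMap.mem_ker, LinearMap.sub_apply,
      TensorProduct.map_tmul, parityMap_of_mem 𝒱 hv, parityMap_of_mem 𝒲 hw,
      TensorProduct.smul_tmul_smul, superSign_mul, add_sub_cancel, LinearMap.smul_apply,
      LinearMap.id_apply, sub_self]
  simpa [sub_eq_zero] using this ht

lemma exists_tensorPart_add (t : V ⊗[ℂ] W) :
    ∃ a ∈ tensorPart 𝒱 𝒲 0, ∃ b ∈ tensorPart 𝒱 𝒲 1, a + b = t := by
  induction t with
  | zero => exact ⟨0, zero_mem _, 0, zero_mem _, by simp⟩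
  | add x y hx hy =>
    obtain ⟨a, ha, b, hb, rfl⟩ := hx
    obtain ⟨a', ha', b', hb', rfl⟩ := hy
    exact ⟨a + a', add_mem ha ha', b + b', add_mem hb hb', by abel⟩
  | tmul v w =>
    have m := superProj_mem 𝒱
    have m' := superProj_mem 𝒲
    refine ⟨superProj 𝒱 0 v ⊗ₜ superProj 𝒲 0 w + superProj 𝒱 1 v ⊗ₜ superProj 𝒲 1 w,
      add_mem (tmul_mem_tensorPart 𝒱 𝒲 (m 0 v) (m' 0 w) (by decide))
        (tmul_mem_tensorPart 𝒱 𝒲 (m 1 v) (m' 1 w) (by decide)),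
      superProj 𝒱 0 v ⊗ₜ superProj 𝒲 1 w + superProj 𝒱 1 v ⊗ₜ superProj 𝒲 0 w,
      add_mem (tmul_mem_tensorPart 𝒱 𝒲 (m 0 v) (m' 1 w) (by decide))
        (tmul_mem_tensorPart 𝒱 𝒲 (m 1 v) (m' 0 w) (by decide)), ?_⟩
    conv_rhs => rw [← superProj_add 𝒱 v, ← superProj_add 𝒲 w]
    simp only [TensorProduct.add_tmul, TensorProduct.tmul_add]
    abel

lemma mem_tensorPart_of_map_parityMap {i : ZMod 2} {t : V ⊗[ℂ] W}
    (ht : TensorProduct.map (parityMap 𝒱) (parityMap 𝒲) t = superSign i • t) :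
    t ∈ tensorPart 𝒱 𝒲 i := by
  obtain ⟨a, ha, b, hb, rfl⟩ := exists_tensorPart_add 𝒱 𝒲 t
  rw [map_add, map_parityMap_of_mem 𝒱 𝒲 ha, map_parityMap_of_mem 𝒱 𝒲 hb] at ht
  rcases zmod_two_cases i with rfl | rfl
  · rw [superSign_zero, superSign_one] at ht
    have h2 : (2 : ℂ) • b = 0 := by linear_combination (norm := module) -ht
    rw [(smul_eq_zero.1 h2).resolve_left two_ne_zero, add_zero]
    exact ha
  · rw [superSign_zero, superSign_one] at ht
    have h2 : (2 : ℂ) • a = 0 := by linear_combination (norm := module) ht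
    rw [(smul_eq_zero.1 h2).resolve_left two_ne_zero, zero_add]
    exact hb

end

end SuperSpace

/-! ### Affine algebraic supergroups -/

/-- A complex affine algebraic supergroup `G`, given by its coordinate superalgebra `ℂ[G]`: a
finitely generated supercommutative Hopf superalgebra over `ℂ`. -/
structure AlgSupergroup where
  /-- The coordinate superalgebra `ℂ[G]`. -/
  Coord : Type
  [ring : Ring Coord]
  [algebra : Algebra ℂ Coord]
  [coalgebra : Coalgebra ℂ Coord]
  /-- The even functions `part 0` and the odd functions `part 1`. -/
  part : ZMod 2 → Submodule ℂ Coord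
  [graded : GradedAlgebra part]
  finiteType : Algebra.FiniteType ℂ Coord
  supercomm : ∀ (i j : ZMod 2), ∀ a ∈ part i, ∀ b ∈ part j, a * b = superSign (i * j) • (b * a)
  comul_even : ∀ i, ∀ a ∈ part i, Coalgebra.comul (R := ℂ) a ∈ tensorPart part part i
  counit_even : ∀ i, ∀ a ∈ part i, Coalgebra.counit (R := ℂ) a ∈ purelyEven ℂ i
  comul_one : Coalgebra.comul (R := ℂ) (1 : Coord) = 1 ⊗ₜ 1
  /-- The comultiplication is multiplicative for the super tensor product of algebras, where
  `(a ⊗ b)(c ⊗ d) = (-1)^{|b||c|} ac ⊗ bd`. -/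
  comul_mul : ∀ a b : Coord,
    GradedTensorProduct.of ℂ part part (Coalgebra.comul (R := ℂ) (a * b)) =
      GradedTensorProduct.of ℂ part part (Coalgebra.comul (R := ℂ) a) *
        GradedTensorProduct.of ℂ part part (Coalgebra.comul (R := ℂ) b)
  counit_one : Coalgebra.counit (R := ℂ) (1 : Coord) = 1
  counit_mul : ∀ a b : Coord, Coalgebra.counit (R := ℂ) (a * b) =
    Coalgebra.counit (R := ℂ) a * Coalgebra.counit (R := ℂ) b
  antipode : Coord →ₗ[ℂ] Coord
  antipode_even : ∀ i, ∀ a ∈ part i, antipode a ∈ part i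
  mul_antipode_rTensor_comul :
    LinearMap.mul' ℂ Coord ∘ₗ antipode.rTensor Coord ∘ₗ Coalgebra.comul =
      Algebra.linearMap ℂ Coord ∘ₗ Coalgebra.counit
  mul_antipode_lTensor_comul :
    LinearMap.mul' ℂ Coord ∘ₗ antipode.lTensor Coord ∘ₗ Coalgebra.comul =
      Algebra.linearMap ℂ Coord ∘ₗ Coalgebra.counit

attribute [instance] AlgSupergroup.ring AlgSupergroup.algebra AlgSupergroup.coalgebra
  AlgSupergroup.graded

/-! ### Comodules and linear reductivity of the underlying even group -/

section Comodule

variable (C : Type*) [AddCommGroup C] [Module ℂ C] [Coalgebra ℂ C]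

/-- `ρ : V → V ⊗ C` is a (right) coaction of the coalgebra `C`. -/
structure IsCoaction {V : Type*} [AddCommGroup V] [Module ℂ V] (ρ : V →ₗ[ℂ] V ⊗[ℂ] C) :
    Prop where
  coassoc : (TensorProduct.assoc ℂ V C C).toLinearMap ∘ₗ ρ.rTensor C ∘ₗ ρ =
    (Coalgebra.comul (R := ℂ) (A := C)).lTensor V ∘ₗ ρ
  counit : (TensorProduct.rid ℂ V).toLinearMap ∘ₗ
    (Coalgebra.counit (R := ℂ) (A := C)).lTensor V ∘ₗ ρ = LinearMap.id

/-- A subspace `U` is a subcomodule if `ρ U ⊆ U ⊗ C`. -/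
def IsSubcomodule {V : Type*} [AddCommGroup V] [Module ℂ V] (ρ : V →ₗ[ℂ] V ⊗[ℂ] C)
    (U : Submodule ℂ V) : Prop :=
  ∀ v ∈ U, ρ v ∈ LinearMap.range (U.subtype.rTensor C)

/-- Every finite-dimensional comodule is completely reducible. For `C` the coordinate ring of an
affine algebraic group `H`, this says that `H` is linearly reductive. -/
def IsLinearlyReductive : Prop :=
  ∀ (V : Type) [AddCommGroup V] [Module ℂ V] [FiniteDimensional ℂ V]
    (ρ : V →ₗ[ℂ] V ⊗[ℂ] C), IsCoaction C ρ →
    ∀ U : Submodule ℂ V, IsSubcomodule C ρ U →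
      ∃ U' : Submodule ℂ V, IsSubcomodule C ρ U' ∧ IsCompl U U'

end Comodule

namespace AlgSupergroup

variable (G K : AlgSupergroup)

/-- The ideal of `ℂ[G]` generated by the odd functions. -/
def oddIdeal : Submodule ℂ G.Coord :=
  (Ideal.span (G.part 1 : Set G.Coord)).restrictScalars ℂ

lemma counit_odd {a : G.Coord} (ha : a ∈ G.part 1) : Coalgebra.counit (R := ℂ) a = 0 := by
  simpa [purelyEven] using G.counit_even 1 a ha

/-- A pure tensor multiplied, in the super tensor product, by an element of `ℂ[G] ⊗ ℂ[G]` of odd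
parity dies in the tensor square of the quotient by the odd ideal. -/
lemma mkQ_mul_odd (s t : G.Coord ⊗[ℂ] G.Coord) (ht : t ∈ tensorPart G.part G.part 1) :
    TensorProduct.map G.oddIdeal.mkQ G.oddIdeal.mkQ
      ((GradedTensorProduct.of ℂ G.part G.part).symm
        (GradedTensorProduct.of ℂ G.part G.part s * GradedTensorProduct.of ℂ G.part G.part t))
      = 0 := by
  have hl : ∀ a b : G.Coord, b ∈ G.part 1 → G.oddIdeal.mkQ (a * b) = 0 := fun a b hb =>
    (Submodule.Quotient.mk_eq_zero _).2 (Ideal.mul_mem_left _ a (Ideal.subset_span hb))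
  let L : G.Coord ⊗[ℂ] G.Coord →ₗ[ℂ]
      (G.Coord ⧸ G.oddIdeal) ⊗[ℂ] (G.Coord ⧸ G.oddIdeal) :=
    TensorProduct.map G.oddIdeal.mkQ G.oddIdeal.mkQ ∘ₗ
      (GradedTensorProduct.of ℂ G.part G.part).symm.toLinearMap ∘ₗ
      LinearMap.mulLeft ℂ (GradedTensorProduct.of ℂ G.part G.part s) ∘ₗ
      (GradedTensorProduct.of ℂ G.part G.part).toLinearMap
  have hL : tensorPart G.part G.part 1 ≤ LinearMap.ker L := by
    refine iSup_le fun j => Submodule.map₂_le.2 fun v hv w hw => ?_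
    rw [LinearMap.mem_ker]
    change TensorProduct.map G.oddIdeal.mkQ G.oddIdeal.mkQ
      ((GradedTensorProduct.of ℂ G.part G.part).symm
        (GradedTensorProduct.of ℂ G.part G.part s *
          GradedTensorProduct.of ℂ G.part G.part (v ⊗ₜ w))) = 0
    have key : ∀ (k : ZMod 2) (a b : G.Coord), b ∈ G.part k →
        TensorProduct.map G.oddIdeal.mkQ G.oddIdeal.mkQ
          ((GradedTensorProduct.of ℂ G.part G.part).symm
            (GradedTensorProduct.of ℂ G.part G.part (a ⊗ₜ b) *
              GradedTensorProduct.of ℂ G.part G.part (v ⊗ₜ w))) = 0 := by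
      intro k a b hb
      have h := GradedTensorProduct.tmul_coe_mul_coe_tmul (R := ℂ) G.part G.part a
        (⟨b, hb⟩ : G.part k) (⟨v, hv⟩ : G.part j) w
      have h0 : G.oddIdeal.mkQ (a * v) ⊗ₜ[ℂ] G.oddIdeal.mkQ (b * w) = 0 := by
        rcases zmod_two_cases j with rfl | rfl
        · rw [hl b w (by simpa using hw), TensorProduct.tmul_zero]
        · rw [hl a v hv, TensorProduct.zero_tmul]
      rcases Int.units_eq_one_or ((-1 : ℤˣ) ^ (k * j)) with h1 | h1
      · rw [h1, one_smul] at h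
        refine (congrArg (fun z => TensorProduct.map G.oddIdeal.mkQ G.oddIdeal.mkQ
          ((GradedTensorProduct.of ℂ G.part G.part).symm z)) h).trans ?_
        simpa using h0
      · rw [h1, Units.neg_smul, one_smul] at h
        refine (congrArg (fun z => TensorProduct.map G.oddIdeal.mkQ G.oddIdeal.mkQ
          ((GradedTensorProduct.of ℂ G.part G.part).symm z)) h).trans ?_
        simpa using h0
    induction s with
    | zero => simp
    | add x y hx hy => rw [map_add, add_mul, map_add, map_add, hx, hy, add_zero]
    | tmul a b =>
      rw [← superProj_add G.part b, TensorProduct.tmul_add, map_add, add_mul, map_add, map_add,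
        key 0 a _ (superProj_mem G.part 0 b), key 1 a _ (superProj_mem G.part 1 b), add_zero]
  exact hL ht

instance : G.oddIdeal.IsCoideal where
  counit_eq_zero x hx := by
    induction hx using Submodule.span_induction with
    | mem x h => exact G.counit_odd h
    | zero => simp
    | add x y _ _ hx hy => rw [map_add, hx, hy, add_zero]
    | smul a x _ hx => rw [smul_eq_mul, G.counit_mul, hx, mul_zero]
  map_mkQ_comul_eq_zero x hx := by
    have key : ∀ y ∈ G.part 1, ∀ a : G.Coord,
        TensorProduct.map G.oddIdeal.mkQ G.oddIdeal.mkQ (Coalgebra.comul (R := ℂ) (a * y)) = 0 :=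
      fun y hy a => by
        have h := G.mkQ_mul_odd (Coalgebra.comul (R := ℂ) a) _ (G.comul_even 1 y hy)
        rwa [← G.comul_mul, LinearEquiv.symm_apply_apply] at h
    suffices h : ∀ a : G.Coord, TensorProduct.map G.oddIdeal.mkQ G.oddIdeal.mkQ
        (Coalgebra.comul (R := ℂ) (a * x)) = 0 by simpa using h 1
    induction hx using Submodule.span_induction with
    | mem x h => exact key x h
    | zero => simp
    | add x y _ _ hx hy => intro a; rw [mul_add, map_add, map_add, hx, hy, add_zero]
    | smul b x _ hx => intro a; rw [smul_eq_mul, ← mul_assoc]; exact hx _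

/-- `G` is quasireductive: its underlying even algebraic group `G₀`, whose coordinate coalgebra is
the quotient of `ℂ[G]` by the ideal generated by the odd functions, is linearly reductive. Over `ℂ`
this is the same as reductivity of the identity component of `G₀`. -/
def IsQuasireductive : Prop := IsLinearlyReductive (G.Coord ⧸ G.oddIdeal)

/-! ### Representations -/

/-- A `G`-module of arbitrary dimension: a super vector space with an even coaction of `ℂ[G]`. -/
structure SMod where
  carrier : Type
  [addCommGroup : AddCommGroup carrier]
  [module : Module ℂ carrier]
  part : ZMod 2 → Submodule ℂ carrier
  [decomposition : DirectSum.Decomposition part]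
  coact : carrier →ₗ[ℂ] carrier ⊗[ℂ] G.Coord
  coact_even : ∀ i, ∀ v ∈ part i, coact v ∈ tensorPart part G.part i
  isCoaction : IsCoaction G.Coord coact

attribute [instance] SMod.addCommGroup SMod.module SMod.decomposition

namespace SMod

variable {G K}

/-- A morphism of `G`-modules: an even `G`-equivariant linear map. -/
@[ext]
structure Hom (M N : G.SMod) where
  toLin : M.carrier →ₗ[ℂ] N.carrier
  even : ∀ i, ∀ v ∈ M.part i, toLin v ∈ N.part i
  equivariant : N.coact ∘ₗ toLin = toLin.rTensor G.Coord ∘ₗ M.coact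

instance : Category G.SMod where
  Hom M N := Hom M N
  id M := ⟨LinearMap.id, fun _ _ h => h, by simp⟩
  comp f g := ⟨g.toLin ∘ₗ f.toLin, fun i v h => g.even i _ (f.even i v h), by
    rw [← LinearMap.comp_assoc, g.equivariant, LinearMap.comp_assoc, f.equivariant,
      LinearMap.rTensor_comp, LinearMap.comp_assoc]⟩

@[ext]
lemma hom_ext {M N : G.SMod} {f g : M ⟶ N} (h : f.toLin = g.toLin) : f = g := Hom.ext h

@[simp] lemma id_toLin (M : G.SMod) : Hom.toLin (𝟙 M) = LinearMap.id := rfl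

@[simp] lemma comp_toLin {M N P : G.SMod} (f : M ⟶ N) (g : N ⟶ P) :
    (f ≫ g).toLin = g.toLin ∘ₗ f.toLin := rfl

/-- The even equivariant maps form a subspace of the space of all linear maps. -/
def homSubmodule (M N : G.SMod) : Submodule ℂ (M.carrier →ₗ[ℂ] N.carrier) where
  carrier := {f | (∀ i, ∀ v ∈ M.part i, f v ∈ N.part i) ∧
    N.coact ∘ₗ f = f.rTensor G.Coord ∘ₗ M.coact}
  zero_mem' := ⟨fun _ _ _ => zero_mem _, by simp⟩
  add_mem' := fun {f g} hf hg => ⟨fun i v h => add_mem (hf.1 i v h) (hg.1 i v h), by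
    rw [LinearMap.comp_add, hf.2, hg.2, LinearMap.rTensor_add, LinearMap.add_comp]⟩
  smul_mem' := fun c f hf => ⟨fun i v h => Submodule.smul_mem _ _ (hf.1 i v h), by
    rw [LinearMap.comp_smul, hf.2, LinearMap.rTensor_smul, LinearMap.smul_comp]⟩

/-- Morphisms are the elements of `homSubmodule`. -/
def homEquiv (M N : G.SMod) : (M ⟶ N) ≃ homSubmodule M N where
  toFun f := ⟨f.toLin, f.even, f.equivariant⟩
  invFun f := ⟨f.1, f.2.1, f.2.2⟩
  left_inv _ := rfl
  right_inv _ := rfl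

instance : Preadditive G.SMod where
  homGroup M N := (homEquiv M N).addCommGroup
  add_comp _ _ _ f f' g := hom_ext (LinearMap.comp_add f.toLin f'.toLin g.toLin)
  comp_add _ _ _ f g g' := hom_ext (LinearMap.add_comp f.toLin g'.toLin g.toLin)

end SMod

/-- The category `Rep G` of finite-dimensional `G`-modules and even `G`-equivariant maps. -/
abbrev RepCat : Type 1 :=
  ObjectProperty.FullSubcategory (fun M : G.SMod => FiniteDimensional ℂ M.carrier)

variable {G}

/-- The superdimension `dim M_0 - dim M_1`. -/
def sdim (M : G.RepCat) : ℤ :=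
  (Module.finrank ℂ (M.obj.part 0) : ℤ) - (Module.finrank ℂ (M.obj.part 1) : ℤ)

/-- The categorical trace of an endomorphism in `Rep G`, which is its supertrace. -/
def str {M : G.RepCat} (f : M ⟶ M) : ℂ := superTrace M.obj.part f.hom.toLin

/-- `f : M ⟶ N` is negligible if `str (f ≫ g) = 0` for every `g : N ⟶ M`. -/
def IsNegligible {M N : G.RepCat} (f : M ⟶ N) : Prop := ∀ g : N ⟶ M, str (f ≫ g) = 0

variable (G)

/-- Congruence modulo the ideal of negligible morphisms. -/
def negligibleRel : HomRel G.RepCat := fun _ _ f f' => IsNegligible (f - f')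

/-- The semisimplification of `Rep G`: the quotient of `Rep G` by the negligible morphisms. -/
abbrev Semisimplification : Type 1 := CategoryTheory.Quotient G.negligibleRel

/-- The semisimplification functor. -/
abbrev semisimplify : G.RepCat ⥤ G.Semisimplification :=
  CategoryTheory.Quotient.functor G.negligibleRel

end AlgSupergroup

/-! ### Indecomposable objects and direct summands -/

section Summands

variable {C : Type*} [Category* C] [Preadditive C]

/-- `X` is a direct sum of `Y` and `Z`. -/
def IsDirectSum (X Y Z : C) : Prop :=
  ∃ b : Limits.BinaryBicone Y Z, Nonempty b.IsBilimit ∧ Nonempty (b.pt ≅ X)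

/-- `Y` is (isomorphic to) a direct summand of `X`. -/
def IsDirectSummand (Y X : C) : Prop := ∃ Z, IsDirectSum X Y Z

/-- `X` is indecomposable: it is nonzero and not a direct sum of two nonzero objects. -/
def IsIndecomposable (X : C) : Prop :=
  ¬ Limits.IsZero X ∧ ∀ Y Z, IsDirectSum X Y Z → Limits.IsZero Y ∨ Limits.IsZero Z

end Summands

namespace AlgSupergroup

variable (G K : AlgSupergroup)

/-- The indecomposable finite-dimensional `G`-modules of nonzero superdimension. -/
abbrev IndecNonzero : Type 1 := {M : G.RepCat // IsIndecomposable M ∧ sdim M ≠ 0}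

/-- Isomorphism of `G`-modules. -/
def indecSetoid : Setoid G.IndecNonzero where
  r M N := Nonempty (M.1 ≅ N.1)
  iseqv := ⟨fun _ => ⟨Iso.refl _⟩, fun ⟨e⟩ => ⟨e.symm⟩, fun ⟨e⟩ ⟨e'⟩ => ⟨e ≪≫ e'⟩⟩

/-- Isomorphism classes of indecomposable `G`-modules of nonzero superdimension. -/
abbrev IndecClass : Type 1 := _root_.Quotient G.indecSetoid

variable {G} in
/-- The isomorphism class of an indecomposable `G`-module of nonzero superdimension. -/
def isoClass (M : G.IndecNonzero) : G.IndecClass := Quotient.mk G.indecSetoid M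

/-! ### Closed subgroups, restriction and induction -/

/-- An embedding of `K` into `G` as a closed subgroup: a surjective homomorphism of Hopf
superalgebras `ℂ[G] → ℂ[K]` (it commutes with the antipodes automatically). -/
structure ClosedEmbedding where
  pullback : G.Coord →ₐ[ℂ] K.Coord
  even : ∀ i, ∀ a ∈ G.part i, pullback a ∈ K.part i
  comul_comp : Coalgebra.comul ∘ₗ pullback.toLinearMap =
    TensorProduct.map pullback.toLinearMap pullback.toLinearMap ∘ₗ Coalgebra.comul
  counit_comp : Coalgebra.counit ∘ₗ pullback.toLinearMap = Coalgebra.counit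
  surjective : Function.Surjective pullback

namespace SMod

variable {G K}

lemma map_parity_coact (M : G.SMod) (v : M.carrier) :
    TensorProduct.map (parityMap M.part) (parityMap G.part) (M.coact v) =
      M.coact (parityMap M.part v) := by
  have key : ∀ i, ∀ v ∈ M.part i,
      TensorProduct.map (parityMap M.part) (parityMap G.part) (M.coact v) =
        M.coact (parityMap M.part v) := fun i v hv => by
    rw [map_parityMap_of_mem M.part G.part (M.coact_even i v hv), parityMap_of_mem M.part hv,
      map_smul]
  rw [← superProj_add M.part v]
  simp only [map_add, key 0 _ (superProj_mem M.part 0 v), key 1 _ (superProj_mem M.part 1 v)]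

/-- Restriction of a `G`-module to the closed subgroup `K`. -/
def restrict (ι : G.ClosedEmbedding K) (M : G.SMod) : K.SMod where
  carrier := M.carrier
  part := M.part
  coact := ι.pullback.toLinearMap.lTensor M.carrier ∘ₗ M.coact
  coact_even i v hv := by
    have h : tensorPart M.part G.part i ≤
        (tensorPart M.part K.part i).comap (ι.pullback.toLinearMap.lTensor M.carrier) := by
      refine iSup_le fun j => Submodule.map₂_le.2 fun v hv w hw => ?_
      exact tmul_mem_tensorPart _ _ hv (ι.even _ _ hw) (by abel)
    exact h (M.coact_even i v hv)
  isCoaction := by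
    have h1 : ∀ t : M.carrier ⊗[ℂ] G.Coord,
        (TensorProduct.assoc ℂ M.carrier K.Coord K.Coord)
          ((ι.pullback.toLinearMap.lTensor M.carrier ∘ₗ M.coact).rTensor K.Coord
            (ι.pullback.toLinearMap.lTensor M.carrier t)) =
        (TensorProduct.map ι.pullback.toLinearMap ι.pullback.toLinearMap).lTensor M.carrier
          (TensorProduct.assoc ℂ M.carrier G.Coord G.Coord (M.coact.rTensor G.Coord t)) := by
      intro t
      induction t with
      | zero => simp
      | add x y hx hy => simp only [map_add, hx, hy]
      | tmul m a =>
        simp only [LinearMap.lTensor_tmul, LinearMap.rTensor_tmul, LinearMap.comp_apply]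
        induction M.coact m with
        | zero => simp
        | add x y hx hy => simp only [map_add, TensorProduct.add_tmul, hx, hy]
        | tmul m b => simp
    constructor
    · ext v
      have h2 := LinearMap.congr_fun M.isCoaction.coassoc v
      simp only [LinearMap.comp_apply, LinearEquiv.coe_coe] at h2 ⊢
      rw [h1, h2, ← LinearMap.comp_apply, ← LinearMap.lTensor_comp, ← ι.comul_comp,
        LinearMap.lTensor_comp, LinearMap.comp_apply]
    · rw [← LinearMap.comp_assoc (M.coact), ← LinearMap.lTensor_comp, ι.counit_comp]
      exact M.isCoaction.counit

/-- The trivial one-dimensional even module `ℂ`. -/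
def triv (G : AlgSupergroup) : G.SMod where
  carrier := ℂ
  part := purelyEven ℂ
  coact := (TensorProduct.mk ℂ ℂ G.Coord).flip 1
  coact_even i v hv := by
    refine tmul_mem_tensorPart _ _ hv (k := 0) ?_ (by simp)
    exact SetLike.GradedOne.one_mem
  isCoaction := by
    constructor
    · ext; simp [G.comul_one]
    · ext; simp [G.counit_one]

/-- The regular module `ℂ[G]`, on which `G` acts by right translations. -/
def regular (G : AlgSupergroup) : G.SMod where
  carrier := G.Coord
  part := G.part
  coact := Coalgebra.comul
  coact_even := G.comul_even
  isCoaction := by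
    constructor
    · exact Coalgebra.coassoc
    · ext a; simp

section Sub

variable (M : G.SMod) (U : Submodule ℂ M.carrier)

lemma rTensor_subtype_injective (E : Type) [AddCommGroup E] [Module ℂ E] :
    Function.Injective (U.subtype.rTensor E) :=
  Module.Flat.rTensor_preserves_injective_linearMap _ U.injective_subtype

/-- A subspace stable under the parity involution is graded. -/
@[reducible]
def subDecomposition (hpar : ∀ v ∈ U, parityMap M.part v ∈ U) :
    DirectSum.Decomposition (fun i => (M.part i).comap U.subtype) :=
  decompositionOfIsCompl _ <| by
    have h0 : ∀ v ∈ U, superProj M.part 0 v ∈ U := fun v hv => by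
      have h : (2 : ℂ) • superProj M.part 0 v = v + parityMap M.part v := by
        nth_rewrite 2 [← superProj_add M.part v]
        simp only [parityMap, LinearMap.sub_apply]
        module
      exact (Submodule.smul_mem_iff _ two_ne_zero).1 (h ▸ add_mem hv (hpar v hv))
    have h1 : ∀ v ∈ U, superProj M.part 1 v ∈ U := fun v hv => by
      rw [eq_sub_iff_add_eq'.2 (superProj_add M.part v)]
      exact sub_mem hv (h0 v hv)
    constructor
    · rw [Submodule.disjoint_def]
      intro v hv0 hv1
      have e0 := superProj_of_mem M.part 0 (Submodule.mem_comap.1 hv0)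
      have e1 := superProj_of_mem M.part 0 (Submodule.mem_comap.1 hv1)
      rw [e0] at e1
      exact Subtype.ext (by simpa using e1)
    · rw [codisjoint_iff, eq_top_iff]
      rintro ⟨v, hv⟩ -
      exact Submodule.mem_sup.2 ⟨⟨_, h0 v hv⟩, superProj_mem M.part 0 v, ⟨_, h1 v hv⟩,
        superProj_mem M.part 1 v, Subtype.ext (superProj_add M.part v)⟩

/-- The coaction induced on a subcomodule. -/
def subCoact (hU : IsSubcomodule G.Coord M.coact U) : U →ₗ[ℂ] U ⊗[ℂ] G.Coord :=
  (LinearEquiv.ofInjective _ (rTensor_subtype_injective M U G.Coord)).symm.toLinearMap ∘ₗ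
    LinearMap.codRestrict (LinearMap.range (U.subtype.rTensor G.Coord))
      (M.coact ∘ₗ U.subtype) (fun v => hU v v.2)

lemma rTensor_subCoact (hU : IsSubcomodule G.Coord M.coact U) (v : U) :
    U.subtype.rTensor G.Coord (subCoact M U hU v) = M.coact v := by
  have h := LinearEquiv.apply_symm_apply
    (LinearEquiv.ofInjective _ (rTensor_subtype_injective M U G.Coord))
    (LinearMap.codRestrict (LinearMap.range (U.subtype.rTensor G.Coord))
      (M.coact ∘ₗ U.subtype) (fun v => hU v v.2) v)
  exact congrArg Subtype.val h

/-- A graded subspace `U` with `ρ U ⊆ U ⊗ ℂ[G]` is again a `G`-module. -/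
def sub (hpar : ∀ v ∈ U, parityMap M.part v ∈ U) (hU : IsSubcomodule G.Coord M.coact U) :
    G.SMod where
  carrier := U
  part := fun i => (M.part i).comap U.subtype
  decomposition := subDecomposition M U hpar
  coact := subCoact M U hU
  coact_even i v hv := by
    let _ := subDecomposition M U hpar
    apply mem_tensorPart_of_map_parityMap
    apply rTensor_subtype_injective M U G.Coord
    have hc : ∀ t : U ⊗[ℂ] G.Coord, U.subtype.rTensor G.Coord
        (TensorProduct.map (parityMap fun i => (M.part i).comap U.subtype) (parityMap G.part) t) =
        TensorProduct.map (parityMap M.part) (parityMap G.part)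
          (U.subtype.rTensor G.Coord t) := by
      intro t
      induction t with
      | zero => simp
      | add x y hx hy => simp only [map_add, hx, hy]
      | tmul u a =>
        have := parityMap_comm (fun i => (M.part i).comap U.subtype) M.part U.subtype
          (fun _ _ h => h) u
        simp only [TensorProduct.map_tmul, LinearMap.rTensor_tmul, this]
    rw [hc, map_smul, rTensor_subCoact,
      map_parityMap_of_mem M.part G.part (M.coact_even i v hv)]
  isCoaction := by
    constructor
    · ext v
      apply rTensor_subtype_injective M U (G.Coord ⊗[ℂ] G.Coord)
      have h1 : ∀ t : U ⊗[ℂ] G.Coord, U.subtype.rTensor (G.Coord ⊗[ℂ] G.Coord)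
          (TensorProduct.assoc ℂ U G.Coord G.Coord ((subCoact M U hU).rTensor G.Coord t)) =
          TensorProduct.assoc ℂ M.carrier G.Coord G.Coord
            (M.coact.rTensor G.Coord (U.subtype.rTensor G.Coord t)) := by
        intro t
        induction t with
        | zero => simp
        | add x y hx hy => simp only [map_add, hx, hy]
        | tmul u a =>
          simp only [LinearMap.rTensor_tmul, Submodule.subtype_apply]
          rw [← rTensor_subCoact M U hU u]
          induction subCoact M U hU u with
          | zero => simp
          | add x y hx hy => simp only [map_add, TensorProduct.add_tmul, hx, hy]
          | tmul m b => simp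
      have h2 : ∀ t : U ⊗[ℂ] G.Coord, U.subtype.rTensor (G.Coord ⊗[ℂ] G.Coord)
          ((Coalgebra.comul (R := ℂ) (A := G.Coord)).lTensor U t) =
          (Coalgebra.comul (R := ℂ) (A := G.Coord)).lTensor M.carrier
            (U.subtype.rTensor G.Coord t) := by
        intro t
        induction t with
        | zero => simp
        | add x y hx hy => simp only [map_add, hx, hy]
        | tmul u a => simp
      simp only [LinearMap.comp_apply, LinearEquiv.coe_coe]
      rw [h1, h2, rTensor_subCoact]
      exact LinearMap.congr_fun M.isCoaction.coassoc v
    · ext v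
      have h1 : ∀ t : U ⊗[ℂ] G.Coord, (TensorProduct.rid ℂ U
          ((Coalgebra.counit (R := ℂ) (A := G.Coord)).lTensor U t) : M.carrier) =
          TensorProduct.rid ℂ M.carrier
            ((Coalgebra.counit (R := ℂ) (A := G.Coord)).lTensor M.carrier
              (U.subtype.rTensor G.Coord t)) := by
        intro t
        induction t with
        | zero => simp
        | add x y hx hy => simp only [map_add, Submodule.coe_add, hx, hy]
        | tmul u a => simp
      simp only [LinearMap.comp_apply, LinearEquiv.coe_coe]
      rw [h1, rTensor_subCoact]
      exact LinearMap.congr_fun M.isCoaction.counit v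

end Sub

variable {M N : G.SMod}

/-- Restriction to a closed subgroup, as a functor. -/
def resFunctor (ι : G.ClosedEmbedding K) : G.SMod ⥤ K.SMod where
  obj M := restrict ι M
  map {M N} f := ⟨f.toLin, f.even, by
    change (ι.pullback.toLinearMap.lTensor N.carrier ∘ₗ N.coact) ∘ₗ f.toLin =
      f.toLin.rTensor K.Coord ∘ₗ ι.pullback.toLinearMap.lTensor M.carrier ∘ₗ M.coact
    rw [LinearMap.comp_assoc, f.equivariant, ← LinearMap.comp_assoc, ← LinearMap.comp_assoc,
      LinearMap.lTensor_comp_rTensor, LinearMap.rTensor_comp_lTensor]⟩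

end SMod

namespace ClosedEmbedding

variable {G K} (ι : G.ClosedEmbedding K)

/-- The restriction functor `Rep G ⥤ Rep K`. -/
def res : G.RepCat ⥤ K.RepCat :=
  ObjectProperty.lift _ (ObjectProperty.ι _ ⋙ SMod.resFunctor ι) (fun M => M.property)

/-- The underlying space of `Ind_K^G ℂ = ℂ[G/K]`: the functions `f` on `G` with
`f (k g) = f g` for `k` in `K`, that is, whose image in `ℂ[K] ⊗ ℂ[G]` is `1 ⊗ f`. -/
def indSubmodule : Submodule ℂ G.Coord :=
  LinearMap.ker (ι.pullback.toLinearMap.rTensor G.Coord ∘ₗ Coalgebra.comul -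
    TensorProduct.mk ℂ K.Coord G.Coord 1)

lemma mem_indSubmodule {f : G.Coord} : f ∈ ι.indSubmodule ↔
    ι.pullback.toLinearMap.rTensor G.Coord (Coalgebra.comul (R := ℂ) f) = 1 ⊗ₜ f := by
  simp [indSubmodule, LinearMap.mem_ker, sub_eq_zero]

lemma parityMap_mem_indSubmodule (f : G.Coord) (hf : f ∈ ι.indSubmodule) :
    parityMap G.part f ∈ ι.indSubmodule := by
  rw [mem_indSubmodule] at hf ⊢
  have h1 : Coalgebra.comul (R := ℂ) (parityMap G.part f) =
      TensorProduct.map (parityMap G.part) (parityMap G.part) (Coalgebra.comul (R := ℂ) f) :=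
    ((SMod.regular G).map_parity_coact f).symm
  have h2 : ∀ t : G.Coord ⊗[ℂ] G.Coord, ι.pullback.toLinearMap.rTensor G.Coord
      (TensorProduct.map (parityMap G.part) (parityMap G.part) t) =
      TensorProduct.map (parityMap K.part) (parityMap G.part)
        (ι.pullback.toLinearMap.rTensor G.Coord t) := by
    intro t
    induction t with
    | zero => simp
    | add x y hx hy => simp only [map_add, hx, hy]
    | tmul a b =>
      have := parityMap_comm G.part K.part ι.pullback.toLinearMap ι.even a
      simp only [TensorProduct.map_tmul, LinearMap.rTensor_tmul, this]
  have h3 : parityMap K.part (1 : K.Coord) = 1 := by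
    rw [parityMap_of_mem K.part (SetLike.GradedOne.one_mem (A := K.part)), superSign_zero,
      one_smul]
  rw [h1, h2, hf, TensorProduct.map_tmul, h3]

lemma isSubcomodule_indSubmodule :
    IsSubcomodule G.Coord (SMod.regular G).coact ι.indSubmodule := by
  intro (f : G.Coord) (hf : f ∈ ι.indSubmodule)
  have hex : Function.Exact ι.indSubmodule.subtype
      (ι.pullback.toLinearMap.rTensor G.Coord ∘ₗ Coalgebra.comul -
        TensorProduct.mk ℂ K.Coord G.Coord 1) := LinearMap.exact_subtype_ker_map _
  have hex' := Module.Flat.rTensor_exact G.Coord hex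
  refine (hex' _).1 ?_
  replace hf := ι.mem_indSubmodule.1 hf
  change LinearMap.rTensor G.Coord (ι.pullback.toLinearMap.rTensor G.Coord ∘ₗ
    Coalgebra.comul - TensorProduct.mk ℂ K.Coord G.Coord 1) (Coalgebra.comul (R := ℂ) f) = 0
  apply (TensorProduct.assoc ℂ K.Coord G.Coord G.Coord).injective
  have h1 : ∀ t : G.Coord ⊗[ℂ] G.Coord,
      TensorProduct.assoc ℂ K.Coord G.Coord G.Coord (LinearMap.rTensor G.Coord
        (ι.pullback.toLinearMap.rTensor G.Coord ∘ₗ Coalgebra.comul -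
          TensorProduct.mk ℂ K.Coord G.Coord 1) t) =
      ι.pullback.toLinearMap.rTensor (G.Coord ⊗[ℂ] G.Coord)
        (TensorProduct.assoc ℂ G.Coord G.Coord G.Coord
          ((Coalgebra.comul (R := ℂ) (A := G.Coord)).rTensor G.Coord t)) - 1 ⊗ₜ t := by
    intro t
    induction t with
    | zero => simp
    | add x y hx hy => simp only [map_add, hx, hy, TensorProduct.tmul_add]; abel
    | tmul a b =>
      simp only [LinearMap.rTensor_tmul, LinearMap.sub_apply, LinearMap.comp_apply,
        TensorProduct.sub_tmul, map_sub, TensorProduct.mk_apply, TensorProduct.assoc_tmul]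
      congr 1
      induction Coalgebra.comul (R := ℂ) a with
      | zero => simp
      | add x y hx hy => simp only [map_add, TensorProduct.add_tmul, hx, hy]
      | tmul m n => simp
  have h2 : ∀ t : G.Coord ⊗[ℂ] G.Coord, ι.pullback.toLinearMap.rTensor (G.Coord ⊗[ℂ] G.Coord)
      ((Coalgebra.comul (R := ℂ) (A := G.Coord)).lTensor G.Coord t) =
      (Coalgebra.comul (R := ℂ) (A := G.Coord)).lTensor K.Coord
        (ι.pullback.toLinearMap.rTensor G.Coord t) := by
    intro t
    induction t with
    | zero => simp
    | add x y hx hy => simp only [map_add, hx, hy]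
    | tmul u a => simp
  rw [h1, Coalgebra.coassoc_apply, h2, hf, LinearMap.lTensor_tmul, sub_self, map_zero]

/-- The `G`-module `Ind_K^G ℂ`, with `G` acting by right translations. -/
def ind : G.SMod :=
  (SMod.regular G).sub ι.indSubmodule ι.parityMap_mem_indSubmodule ι.isSubcomodule_indSubmodule

lemma one_mem_indSubmodule : (1 : G.Coord) ∈ ι.indSubmodule := by
  rw [mem_indSubmodule, G.comul_one]
  simp

/-- The natural `G`-map `ℂ → Ind_K^G ℂ`, sending `1` to the constant function `1`; it corresponds
to the identity of `ℂ` under Frobenius reciprocity. -/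
def unit : SMod.triv G ⟶ ι.ind where
  toLin := LinearMap.toSpanSingleton ℂ ι.indSubmodule ⟨1, ι.one_mem_indSubmodule⟩
  even i (v : ℂ) (hv : v ∈ purelyEven ℂ i) := by
    change v • (1 : G.Coord) ∈ G.part i
    rcases zmod_two_cases i with rfl | rfl
    · exact Submodule.smul_mem _ _ (SetLike.GradedOne.one_mem (A := G.part))
    · have : v = 0 := by simpa [purelyEven] using hv
      simp [this]
  equivariant := by
    apply LinearMap.ext
    intro (v : ℂ)
    apply SMod.rTensor_subtype_injective (SMod.regular G) ι.indSubmodule G.Coord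
    refine (SMod.rTensor_subCoact (SMod.regular G) ι.indSubmodule
      ι.isSubcomodule_indSubmodule _).trans ?_
    change Coalgebra.comul (R := ℂ) (v • (1 : G.Coord)) = (v • (1 : G.Coord)) ⊗ₜ[ℂ] (1 : G.Coord)
    rw [map_smul, G.comul_one, TensorProduct.smul_tmul']

/-- `K` is a splitting subgroup of `G`: it is quasireductive and the natural map
`ℂ → Ind_K^G ℂ` is a split monomorphism of `G`-modules. -/
def IsSplitting : Prop := K.IsQuasireductive ∧ IsSplitMono ι.unit

end ClosedEmbedding

/-! ### Odd elements of the Lie superalgebra and the functor `DS` -/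

/-- An element `x` of the odd part of the Lie superalgebra `Lie G`: an odd derivation `ℂ[G] → ℂ` at
the identity. (The Koszul sign in `x (ab) = x a ε(b) + (-1)^{|a|} ε(a) x b` is invisible, since the
counit `ε` vanishes on odd functions.) -/
structure LieOdd where
  toLin : G.Coord →ₗ[ℂ] ℂ
  odd : ∀ a ∈ G.part 0, toLin a = 0
  leibniz : ∀ a b : G.Coord, toLin (a * b) =
    toLin a * Coalgebra.counit (R := ℂ) b + Coalgebra.counit (R := ℂ) a * toLin b

namespace LieOdd

variable {G} (x : G.LieOdd)

/-- The even element `[x, x] = 2 x²` of `Lie G`, as a derivation `ℂ[G] → ℂ` at the identity. Here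
`x²` is the product in the superalgebra dual to `ℂ[G]`, namely
`(x y)(a) = ∑ (-1)^{|y| |a₁|} x(a₁) y(a₂)`, which for `x = y` odd is `-∑ x(a₁) x(a₂)`. -/
def selfBracket : G.Coord →ₗ[ℂ] ℂ :=
  (-2 : ℂ) • (LinearMap.mul' ℂ ℂ ∘ₗ TensorProduct.map x.toLin x.toLin ∘ₗ Coalgebra.comul)

/-- `x` is homological: `[x, x]` is a semisimple element of the Lie algebra of the even group, in
the sense that it acts semisimply on the regular representation, by `f ↦ ∑ f₁ [x, x](f₂)`.
(Every representation embeds in a sum of copies of the regular one, so `[x, x]` then acts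
semisimply in every representation.) -/
def IsHomological : Prop :=
  Module.End.IsSemisimple (R := ℂ) (M := G.Coord)
    ((TensorProduct.rid ℂ G.Coord).toLinearMap ∘ₗ x.selfBracket.lTensor G.Coord ∘ₗ
      Coalgebra.comul)

/-- The action of an odd `x` on a `G`-module, `x v = (-1)^{|v|} ∑ v₀ x(v₁)`; the sign comes from
moving `x` past the vector. -/
def act (M : G.SMod) : M.carrier →ₗ[ℂ] M.carrier :=
  (TensorProduct.rid ℂ M.carrier).toLinearMap ∘ₗ x.toLin.lTensor M.carrier ∘ₗ M.coact ∘ₗ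
    parityMap M.part

/-- `DS_x M = Ker x / (Im x ∩ Ker x)`. -/
abbrev DS (M : G.SMod) : Type :=
  LinearMap.ker (x.act M) ⧸ (LinearMap.range (x.act M)).comap (LinearMap.ker (x.act M)).subtype

/-- The part of parity `i` of `DS_x M`: the classes of the vectors of parity `i` in `Ker x`. -/
def DSPart (M : G.SMod) (i : ZMod 2) : Submodule ℂ (x.DS M) :=
  ((M.part i).comap (LinearMap.ker (x.act M)).subtype).map (Submodule.mkQ _)

end LieOdd

variable {G K} in
/-- The closed subgroup `K` of the quasireductive supergroup `G` forms a proper pair `(G, K)`: it is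
splitting and, for some homological `x` in the odd part of `Lie K`, the super vector spaces
`DS_x Ind_K^G ℂ` and `ℂ` are isomorphic. -/
def ClosedEmbedding.IsProper (ι : G.ClosedEmbedding K) : Prop :=
  G.IsQuasireductive ∧ ι.IsSplitting ∧ ∃ x : K.LieOdd, x.IsHomological ∧
    ∃ e : x.DS (ι.ind.restrict ι) ≃ₗ[ℂ] ℂ,
      ∀ i, (x.DSPart (ι.ind.restrict ι) i).map e.toLinearMap = purelyEven ℂ i

end AlgSupergroup

end

/-!
Let `φ : M → N` be a `K`-equivariant map between finite-dimensional `G`-modules. The function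
`g ↦ g⁻¹ φ g` is invariant under left translations by `K`, hence a function on the quotient with
values in `Hom (M, N)` (`conjMatrix_mem_indSubmodule`). A left inverse of the inclusion of the
constants into `Ind_K^G ℂ` is an invariant functional `r` on such functions, and averaging
`g⁻¹ φ g` with `r` gives a `G`-equivariant map `φ'` (`equivariant_of_invariant_functional`).

The key point is that `φ - φ'` is negligible already as a `K`-equivariant map. Let `x` be a
homological element with `DS_x (Ind_K^G ℂ) ≅ ℂ`. The invariant functional kills the image of `x`
and maps the constant `1` to `1`, so the line `DS_x (Ind_K^G ℂ)` is spanned by the constants, and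
`x` is exact on the kernel of `r`. As the square of `x` acts semisimply on every comodule, there is
an odd operator `h` on functions on the quotient with `x h + h x = 1 - r`
(`exists_homotopy`, `exists_contraction`). Now let `ψ : N → M` be `K`-equivariant and suppose that
`Φ = g⁻¹ φ g` has average zero. Put `Ψ = g⁻¹ ψ g`. Since `x` differentiates `Φ` and `Ψ` by
supercommutators with the matrix of `x`, the supertrace of `Ψ Φ` equals `x (str (Ψ * h Φ))`, and `r`
kills it. But `str (Ψ Φ) = str (ψ φ)` is a constant, so it is zero (`superTrace_eq_zero`).

Hence, modulo negligible maps, every `K`-equivariant map between `G`-modules is `G`-equivariant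
(`exists_lift`). So restriction preserves negligible maps and induces a full functor of
semisimplifications, which is unique because the functor to a quotient category is bijective on
objects and full.

For an indecomposable module, Fitting's lemma (`isIso_or_isNilpotent`) shows that endomorphisms are
scalars modulo negligible ones (`exists_scalar`), and by the lifting result the same holds for the
`K`-endomorphisms of an indecomposable `G`-module (`exists_scalar_res`). The idempotents of summands
of nonzero superdimension of the restriction are then nonzero scalars, so two such summands are
isomorphic and never complementary (`str_idempotents_ne_zero`). Injectivity follows by lifting the
two maps through a common summand to `G`-equivariant maps whose composition has nonzero supertrace
(`nonempty_iso_of_common_summand`).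
-/

set_option linter.unusedSectionVars false

noncomputable section

/-! ### Semisimple operators and contracting homotopies -/

section LinearAlgebra

/-- A semisimple operator, on a space of any dimension, splits off its kernel. -/
lemma isCompl_ker_range_of_isSemisimple {k V : Type*} [Field k] [AddCommGroup V] [Module k V]
    {f : Module.End k V} (hf : f.IsSemisimple) :
    IsCompl (LinearMap.ker f) (LinearMap.range f) := by
  rw [Module.End.isSemisimple_iff] at hf
  obtain ⟨q, hq, hc⟩ := hf (LinearMap.ker f) (fun v hv => by
    simp only [Submodule.mem_comap, LinearMap.mem_ker] at hv ⊢; rw [hv, map_zero])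
  have hq' : ∀ v ∈ q, f v ∈ q := hq
  have hdisj : ∀ v ∈ q, f v = 0 → v = 0 := fun v hv h0 =>
    Submodule.disjoint_def.1 hc.disjoint v h0 hv
  -- `f` is injective on `q`, and surjective onto `q` because `f q` has a stable complement.
  have hsurj : ∀ b ∈ q, ∃ b' ∈ q, f b' = b := by
    obtain ⟨r, hr, hc'⟩ := hf (q.map f) (by
      rintro _ ⟨v, hv, rfl⟩
      exact ⟨f v, hq' v hv, rfl⟩)
    intro b hb
    have hbt : b ∈ q.map f ⊔ r := hc'.sup_eq_top ▸ Submodule.mem_top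
    obtain ⟨_, ⟨b', hb', rfl⟩, c, hcr, e⟩ := Submodule.mem_sup.1 hbt
    have hcq : c ∈ q := by
      rw [eq_sub_iff_add_eq'.2 e]
      exact sub_mem hb (hq' _ hb')
    have : c = 0 := hdisj c hcq
      (Submodule.disjoint_def.1 hc'.disjoint _ ⟨c, hcq, rfl⟩ (hr hcr))
    exact ⟨b', hb', by rw [← e, this, add_zero]⟩
  have : LinearMap.range f = q := by
    apply le_antisymm
    · rintro _ ⟨v, rfl⟩
      have hv : v ∈ LinearMap.ker f ⊔ q := hc.sup_eq_top ▸ Submodule.mem_top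
      obtain ⟨a, ha, b, hb, rfl⟩ := Submodule.mem_sup.1 hv
      rw [map_add, LinearMap.mem_ker.1 ha, zero_add]
      exact hq' b hb
    · intro b hb
      obtain ⟨b', -, h⟩ := hsurj b hb
      exact ⟨b', h⟩
  rw [this]
  exact hc

section Intertwiner

variable {k V W : Type*} [Field k] [AddCommGroup V] [Module k V] [AddCommGroup W] [Module k W]
  {f : Module.End k V} {g : Module.End k W}

/-- An intertwiner of two operators, as a map of modules over the polynomial ring. -/
def intertwinerAEval (φ : V →ₗ[k] W) (h : ∀ v, φ (f v) = g (φ v)) :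
    Module.AEval' f →ₗ[Polynomial k] Module.AEval' g :=
  LinearMap.ofAEval f ((Module.AEval'.of g).toLinearMap ∘ₗ φ) (fun v => by
    simp [Module.AEval'.X_smul_of, h])

lemma intertwinerAEval_of (φ : V →ₗ[k] W) (h : ∀ v, φ (f v) = g (φ v)) (v : V) :
    intertwinerAEval φ h (Module.AEval'.of f v) = Module.AEval'.of g (φ v) := rfl

lemma isSemisimple_of_intertwiner_injective (φ : V →ₗ[k] W) (h : ∀ v, φ (f v) = g (φ v))
    (hφ : Function.Injective φ) (hg : g.IsSemisimple) : f.IsSemisimple := by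
  have : IsSemisimpleModule (Polynomial k) (Module.AEval' g) := hg
  exact IsSemisimpleModule.of_injective (intertwinerAEval φ h) hφ

lemma isSemisimple_of_intertwiners_span {ι : Type*} (φ : ι → V →ₗ[k] W)
    (h : ∀ i v, φ i (f v) = g (φ i v)) (hf : f.IsSemisimple)
    (hspan : ⨆ i, LinearMap.range (φ i) = ⊤) : g.IsSemisimple := by
  have : IsSemisimpleModule (Polynomial k) (Module.AEval' f) := hf
  refine isSemisimpleModule_of_isSemisimpleModule_submodule'
    (p := fun i => LinearMap.range (intertwinerAEval (φ i) (h i))) (fun i => .range _) ?_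
  rw [eq_top_iff]
  intro w _
  obtain ⟨w, rfl⟩ := (Module.AEval'.of g).surjective w
  have hw : w ∈ ⨆ i, LinearMap.range (φ i) := hspan ▸ Submodule.mem_top
  induction hw using Submodule.iSup_induction' with
  | mem i x hx =>
    obtain ⟨v, rfl⟩ := hx
    exact Submodule.mem_iSup_of_mem i ⟨Module.AEval'.of f v, intertwinerAEval_of _ _ _⟩
  | zero => rw [map_zero]; exact zero_mem _
  | add x y _ _ hx hy => rw [map_add]; exact add_mem (hx trivial) (hy trivial)

lemma isSemisimple_lTensor (hf : f.IsSemisimple) (U : Type*) [AddCommGroup U] [Module k U] :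
    Module.End.IsSemisimple (R := k) (M := U ⊗[k] V) (f.lTensor U) := by
  refine isSemisimple_of_intertwiners_span (TensorProduct.mk k U V) (fun u v => by simp) hf ?_
  rw [eq_top_iff]
  intro t _
  induction t with
  | zero => exact zero_mem _
  | add x y hx hy => exact add_mem (hx trivial) (hy trivial)
  | tmul u v => exact Submodule.mem_iSup_of_mem u ⟨v, rfl⟩

end Intertwiner

/-- An operator that splits off its kernel has an inverse on its range, extended by zero, which
commutes with everything that commutes with the operator. -/
lemma exists_inverse_on_range {k V : Type*} [Field k] [AddCommGroup V] [Module k V]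
    (S : V →ₗ[k] V) (hc : IsCompl (LinearMap.ker S) (LinearMap.range S)) :
    ∃ s : V →ₗ[k] V, (∀ v, S (s (S v)) = S v) ∧
      ∀ T : V →ₗ[k] V, (∀ v, T (S v) = S (T v)) → ∀ v, s (T v) = T (s v) := by
  have hdec : ∀ v, ∃ a, S a = 0 ∧ ∃ w, a + S w = v := fun v => by
    have hv : v ∈ LinearMap.ker S ⊔ LinearMap.range S := hc.sup_eq_top ▸ Submodule.mem_top
    obtain ⟨a, ha, _, ⟨w, rfl⟩, h⟩ := Submodule.mem_sup.1 hv
    exact ⟨a, ha, w, h⟩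
  have hdisj : ∀ v ∈ LinearMap.range S, S v = 0 → v = 0 := fun v hv h0 =>
    Submodule.disjoint_def.1 hc.disjoint v h0 hv
  have hbij : Function.Bijective (S.restrict (p := LinearMap.range S)
      (q := LinearMap.range S) (fun v _ => S.mem_range_self v)) := by
    constructor
    · rw [injective_iff_map_eq_zero]
      rintro ⟨v, hv⟩ h
      exact Subtype.ext (hdisj v hv (congrArg Subtype.val h))
    · rintro ⟨_, v, rfl⟩
      obtain ⟨a, ha, w, rfl⟩ := hdec v
      exact ⟨⟨S w, w, rfl⟩, Subtype.ext (by
        change S (S w) = S (a + S w)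
        rw [map_add S, ha, zero_add])⟩
  let q := LinearEquiv.ofBijective _ hbij
  let s : V →ₗ[k] V := (LinearMap.range S).subtype ∘ₗ q.symm.toLinearMap ∘ₗ
    Submodule.projectionOnto _ _ hc.symm
  have hs1 : ∀ v, S v = 0 → s v = 0 := fun v hv => by
    have : Submodule.projectionOnto _ _ hc.symm v = 0 :=
      (Submodule.projectionOnto_apply_eq_zero_iff hc.symm).2 hv
    simp [s, this]
  have hs2 : ∀ w, S (s (S w)) = S w := fun w => by
    have : Submodule.projectionOnto _ _ hc.symm (S w) = ⟨S w, w, rfl⟩ :=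
      Submodule.projectionOnto_apply_left hc.symm ⟨S w, w, rfl⟩
    simp only [s, LinearMap.comp_apply, this]
    exact congrArg Subtype.val (q.apply_symm_apply ⟨S w, w, rfl⟩)
  have hs3 : ∀ v, s v ∈ LinearMap.range S := fun v => Subtype.property _
  refine ⟨s, hs2, fun T hT v => ?_⟩
  obtain ⟨a, ha, w, rfl⟩ := hdec v
  have hTa : S (T a) = 0 := by rw [← hT, ha, map_zero]
  rw [map_add T, map_add s, map_add s, hs1 a ha, hs1 _ hTa, zero_add, zero_add, hT]
  obtain ⟨z, hz⟩ := hs3 (S w)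
  refine sub_eq_zero.1 (hdisj _ (sub_mem (hs3 _) ⟨T z, ?_⟩) ?_)
  · rw [← hT, hz]
  · rw [map_sub, hs2, ← hT (s (S w)), hs2, hT, sub_self]

/-- If `V` is the direct sum of the kernel and the range of `R²`, and the homology of `R` is
concentrated in the range of a projection `e`, then `R` has a contracting homotopy relative
to `e`: on the range of `R²` half the inverse of `R` works, and on the kernel of `R²` the operator
`R` is a differential. -/
lemma exists_homotopy {k V : Type*} [Field k] [NeZero (2 : k)] [AddCommGroup V] [Module k V]
    (R e : V →ₗ[k] V) (hc : IsCompl (LinearMap.ker (R ∘ₗ R)) (LinearMap.range (R ∘ₗ R)))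
    (hRe : ∀ v, R (e v) = 0) (heR : ∀ v, e (R v) = 0) (hee : ∀ v, e (e v) = e v)
    (hex : ∀ v, R v = 0 → e v = 0 → v ∈ LinearMap.range R) :
    ∃ h : V →ₗ[k] V, ∀ v, R (h v) + h (R v) = v - e v := by
  obtain ⟨s, hs, hcomm⟩ := exists_inverse_on_range (R ∘ₗ R) hc
  have hsR : ∀ v, s (R v) = R (s v) := hcomm R fun v => rfl
  have hs' : ∀ v, R (R (s (R (R v)))) = R (R v) := hs
  -- `t` is a section of `R` over its range with `e t = 0`.
  obtain ⟨t, ht, het⟩ : ∃ t : V →ₗ[k] V, (∀ v, R (t (R v)) = R v) ∧ ∀ v, e (t v) = 0 := by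
    obtain ⟨r, hr⟩ := R.rangeRestrict.exists_rightInverse_of_surjective R.range_rangeRestrict
    obtain ⟨t, ht⟩ := LinearMap.exists_extend r
    refine ⟨t - e ∘ₗ t, fun v => ?_, fun v => by simp [hee]⟩
    have h1 : t (R v) = r ⟨R v, v, rfl⟩ := LinearMap.congr_fun ht ⟨R v, v, rfl⟩
    have h2 : R (r ⟨R v, v, rfl⟩) = R v :=
      congrArg Subtype.val (LinearMap.congr_fun hr ⟨R v, v, rfl⟩)
    simp [hRe, h1, h2]
  let h₀ : V →ₗ[k] V := t ∘ₗ (LinearMap.id - e) - t ∘ₗ t ∘ₗ R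
  have h0 : ∀ a, R (R a) = 0 → R (h₀ a) + h₀ (R a) = a - e a := by
    intro a ha
    obtain ⟨c, hc⟩ := hex (a - e a - t (R a)) (by simp [hRe, ht]) (by simp [hee, het])
    have h1 : h₀ a = t (R c) := by simp [h₀, hc]
    have h2 : h₀ (R a) = t (R a) := by simp [h₀, ha, heR]
    rw [h1, h2, ht, hc, sub_add_cancel]
  refine ⟨h₀ ∘ₗ (LinearMap.id - R ∘ₗ R ∘ₗ s) + (2 : k)⁻¹ • R ∘ₗ s, fun v => ?_⟩
  have ha := h0 (v - R (R (s v))) (by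
    rw [map_sub, map_sub, ← hsR, ← hsR, hs', sub_self])
  simp only [map_sub, heR, sub_zero] at ha
  have h2 : (2 : k)⁻¹ • R (R (s v)) + (2 : k)⁻¹ • R (R (s v)) = R (R (s v)) := by
    rw [← two_smul k ((2 : k)⁻¹ • R (R (s v))), smul_smul, mul_inv_cancel₀ two_ne_zero, one_smul]
  simp only [LinearMap.add_apply, LinearMap.comp_apply, LinearMap.sub_apply, LinearMap.id_apply,
    LinearMap.smul_apply, map_add, map_smul, hsR, map_sub] at ha ⊢
  linear_combination (norm := module) ha + h2

end LinearAlgebra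

namespace AlgSupergroup

/-! ### Multiplicativity of the comultiplication -/

section Coordinate

variable (G : AlgSupergroup)

lemma one_mem_part : (1 : G.Coord) ∈ G.part 0 := SetLike.GradedOne.one_mem (A := G.part)

lemma mul_mem_part {i j : ZMod 2} {a b : G.Coord} (ha : a ∈ G.part i) (hb : b ∈ G.part j) :
    a * b ∈ G.part (i + j) := SetLike.GradedMul.mul_mem ha hb

/-- Induction on homogeneous elements of a super vector space. -/
lemma part_induction {V : Type*} [AddCommGroup V] [Module ℂ V] (𝒱 : ZMod 2 → Submodule ℂ V)
    [DirectSum.Decomposition 𝒱] {motive : V → Prop} (h : ∀ i, ∀ v ∈ 𝒱 i, motive v)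
    (hadd : ∀ v w, motive v → motive w → motive (v + w)) (v : V) : motive v := by
  rw [← superProj_add 𝒱 v]
  exact hadd _ _ (h 0 _ (superProj_mem 𝒱 0 v)) (h 1 _ (superProj_mem 𝒱 1 v))

lemma parityMap_mul (a b : G.Coord) :
    parityMap G.part (a * b) = parityMap G.part a * parityMap G.part b := by
  induction a using part_induction G.part with
  | hadd a a' h h' => rw [add_mul, map_add, map_add, h, h', add_mul]
  | h i a ha =>
    induction b using part_induction G.part with
    | hadd b b' h h' => rw [mul_add, map_add, map_add, h, h', mul_add]
    | h j b hb =>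
      rw [parityMap_of_mem G.part (G.mul_mem_part ha hb), parityMap_of_mem G.part ha,
        parityMap_of_mem G.part hb, smul_mul_smul_comm, superSign_mul]

lemma parityMap_parityMap {V : Type*} [AddCommGroup V] [Module ℂ V]
    (𝒱 : ZMod 2 → Submodule ℂ V) [DirectSum.Decomposition 𝒱] (v : V) :
    parityMap 𝒱 (parityMap 𝒱 v) = v := by
  induction v using part_induction 𝒱 with
  | hadd v w h h' => rw [map_add, map_add, h, h']
  | h i v hv =>
    rw [parityMap_of_mem 𝒱 hv, map_smul, parityMap_of_mem 𝒱 hv, smul_smul, superSign_mul,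
      CharTwo.add_self_eq_zero i, superSign_zero, one_smul]

/-- The comultiplication, as a homomorphism into the super tensor square of `ℂ[G]`. -/
def comulHom : G.Coord →ₐ[ℂ] GradedTensorProduct ℂ G.part G.part :=
  AlgHom.ofLinearMap ((GradedTensorProduct.of ℂ G.part G.part).toLinearMap ∘ₗ Coalgebra.comul)
    (by simp only [LinearMap.comp_apply, G.comul_one]; rfl) G.comul_mul

lemma comulHom_apply (a : G.Coord) :
    G.comulHom a = GradedTensorProduct.of ℂ G.part G.part (Coalgebra.comul (R := ℂ) a) := rfl

variable {G}

/-- `a ⊗ b ↦ φ(a) b`. -/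
def evalLeft (φ : G.Coord →ₗ[ℂ] ℂ) : G.Coord ⊗[ℂ] G.Coord →ₗ[ℂ] G.Coord :=
  (TensorProduct.lid ℂ G.Coord).toLinearMap ∘ₗ φ.rTensor G.Coord

/-- `a ⊗ b ↦ φ(b) a`. -/
def evalRight (φ : G.Coord →ₗ[ℂ] ℂ) : G.Coord ⊗[ℂ] G.Coord →ₗ[ℂ] G.Coord :=
  (TensorProduct.rid ℂ G.Coord).toLinearMap ∘ₗ φ.lTensor G.Coord

@[simp] lemma evalLeft_tmul (φ : G.Coord →ₗ[ℂ] ℂ) (a b : G.Coord) :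
    evalLeft φ (a ⊗ₜ b) = φ a • b := by simp [evalLeft]

@[simp] lemma evalRight_tmul (φ : G.Coord →ₗ[ℂ] ℂ) (a b : G.Coord) :
    evalRight φ (a ⊗ₜ b) = φ b • a := by simp [evalRight]

/-- An even functional on the left factor is linear for multiplication by the right factor. -/
lemma evalLeft_includeRight_mul {φ : G.Coord →ₗ[ℂ] ℂ} (hφ : ∀ a ∈ G.part 1, φ a = 0)
    (b : G.Coord) (s : GradedTensorProduct ℂ G.part G.part) :
    evalLeft φ ((GradedTensorProduct.of ℂ G.part G.part).symm
      (GradedTensorProduct.includeRight G.part G.part b * s)) =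
      b * evalLeft φ ((GradedTensorProduct.of ℂ G.part G.part).symm s) := by
  obtain ⟨s, rfl⟩ := (GradedTensorProduct.of ℂ G.part G.part).surjective s
  induction s with
  | zero => simp
  | add x y hx hy => simp only [map_add, mul_add, hx, hy]
  | tmul a c =>
    induction b using part_induction G.part with
    | hadd b b' h h' => simp only [map_add, add_mul, h, h']
    | h j b hb =>
      induction a using part_induction G.part with
      | hadd a a' h h' => simp only [map_add, TensorProduct.add_tmul, mul_add, h, h']
      | h i a ha =>
        have h := GradedTensorProduct.tmul_coe_mul_coe_tmul (R := ℂ) G.part G.part 1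
          (⟨b, hb⟩ : G.part j) (⟨a, ha⟩ : G.part i) c
        rw [one_mul] at h
        change evalLeft φ ((GradedTensorProduct.of ℂ G.part G.part).symm
          (GradedTensorProduct.tmul ℂ 1 b * GradedTensorProduct.tmul ℂ a c)) = _
        refine (congrArg (fun z => evalLeft φ
          ((GradedTensorProduct.of ℂ G.part G.part).symm z)) h).trans ?_
        rw [LinearEquiv.symm_apply_apply, evalLeft_tmul]
        rcases zmod_two_cases i with rfl | rfl
        · simp
        · rcases Int.units_eq_one_or ((-1 : ℤˣ) ^ (j * 1)) with h1 | h1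
          · rw [h1]; simp [hφ a ha]
          · rw [h1]; simp [hφ a ha]

/-- The infinitesimal right translation `f ↦ ∑ f₁ y(f₂)` along an odd derivation `y` at the
identity is an odd derivation of `ℂ[G]`. -/
lemma evalRight_comul_mul (y : G.LieOdd) (a b : G.Coord) :
    evalRight y.toLin (Coalgebra.comul (R := ℂ) (a * b)) =
      evalRight y.toLin (Coalgebra.comul (R := ℂ) a) * parityMap G.part b +
        a * evalRight y.toLin (Coalgebra.comul (R := ℂ) b) := by
  have key : ∀ s t : G.Coord ⊗[ℂ] G.Coord,
      evalRight y.toLin ((GradedTensorProduct.of ℂ G.part G.part).symm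
        (GradedTensorProduct.of ℂ G.part G.part s * GradedTensorProduct.of ℂ G.part G.part t)) =
      evalRight y.toLin s * parityMap G.part (evalRight Coalgebra.counit t) +
        evalRight Coalgebra.counit s * evalRight y.toLin t := by
    intro s t
    induction s with
    | zero => simp
    | add x x' hx hx' => simp only [map_add, add_mul, hx, hx']; abel
    | tmul a b =>
      induction t with
      | zero => simp
      | add x x' hx hx' => simp only [map_add, mul_add, hx, hx']; abel
      | tmul c d =>
        induction b using part_induction G.part with
        | hadd b b' h h' =>
          simp only [TensorProduct.tmul_add, map_add, add_mul, h, h']; abel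
        | h j b hb =>
          induction c using part_induction G.part with
          | hadd c c' h h' =>
            simp only [TensorProduct.add_tmul, map_add, mul_add, h, h']; abel
          | h i c hc =>
            have h := GradedTensorProduct.tmul_coe_mul_coe_tmul (R := ℂ) G.part G.part a
              (⟨b, hb⟩ : G.part j) (⟨c, hc⟩ : G.part i) d
            refine (congrArg (fun z => evalRight y.toLin
              ((GradedTensorProduct.of ℂ G.part G.part).symm z)) h).trans ?_
            simp only [evalRight_tmul, map_smul, parityMap_of_mem G.part hc]
            rcases zmod_two_cases j with rfl | rfl
            · simp [y.leibniz, y.odd b hb, smul_smul, mul_comm]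
            · rcases zmod_two_cases i with rfl | rfl
              · simp [y.leibniz, G.counit_odd hb, superSign_zero, smul_smul, mul_comm]
              · simp [y.leibniz, G.counit_odd hb, superSign_one, smul_smul, mul_comm]
  have h := key (Coalgebra.comul (R := ℂ) a) (Coalgebra.comul (R := ℂ) b)
  rw [← G.comul_mul, LinearEquiv.symm_apply_apply] at h
  have hε : ∀ c : G.Coord, evalRight Coalgebra.counit (Coalgebra.comul (R := ℂ) c) = c := by
    intro c
    simp [evalRight]
  rw [h, hε, hε]

lemma LieOdd.map_one (y : G.LieOdd) : y.toLin 1 = 0 := y.odd 1 G.one_mem_part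

end Coordinate

/-! ### Functions on the quotient -/

namespace ClosedEmbedding

variable {G K : AlgSupergroup} (ι : G.ClosedEmbedding K)

/-- Restriction of the left factor to `K`, a homomorphism of super tensor products of algebras. -/
def pullbackLeft :
    GradedTensorProduct ℂ G.part G.part →ₐ[ℂ] GradedTensorProduct ℂ K.part G.part :=
  GradedTensorProduct.lift G.part G.part
    ((GradedTensorProduct.includeLeft K.part G.part).comp ι.pullback)
    (GradedTensorProduct.includeRight K.part G.part) (by
      intro i j a b
      have h := GradedTensorProduct.tmul_coe_mul_coe_tmul (R := ℂ) K.part G.part 1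
        b (⟨ι.pullback a, ι.even i a a.2⟩ : K.part i) 1
      rw [one_mul, mul_one] at h
      change GradedTensorProduct.tmul ℂ (ι.pullback a) 1 *
          GradedTensorProduct.tmul ℂ 1 (b : G.Coord) =
        _ • (GradedTensorProduct.tmul ℂ 1 (b : G.Coord) *
          GradedTensorProduct.tmul ℂ (ι.pullback a) 1)
      rw [h, GradedTensorProduct.tmul_one_mul_one_tmul, smul_smul, Int.units_mul_self,
        one_smul])

lemma pullbackLeft_includeLeft (a : G.Coord) :
    ι.pullbackLeft (GradedTensorProduct.includeLeft G.part G.part a) =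
      GradedTensorProduct.includeLeft K.part G.part (ι.pullback a) := by
  refine (GradedTensorProduct.lift_tmul G.part G.part _ _ _ a 1).trans ?_
  rw [map_one, mul_one]
  rfl

lemma pullbackLeft_includeRight (a : G.Coord) :
    ι.pullbackLeft (GradedTensorProduct.includeRight G.part G.part a) =
      GradedTensorProduct.includeRight K.part G.part a := by
  refine (GradedTensorProduct.lift_tmul G.part G.part _ _ _ 1 a).trans ?_
  rw [map_one, one_mul]

lemma pullbackLeft_comulHom (a : G.Coord) : ι.pullbackLeft (G.comulHom a) =
    GradedTensorProduct.of ℂ K.part G.part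
      (ι.pullback.toLinearMap.rTensor G.Coord (Coalgebra.comul (R := ℂ) a)) := by
  rw [comulHom_apply]
  induction Coalgebra.comul (R := ℂ) a with
  | zero => simp
  | add x y hx hy => simp only [map_add, hx, hy]
  | tmul b c =>
    refine (GradedTensorProduct.lift_tmul G.part G.part _ _ _ b c).trans ?_
    rw [LinearMap.rTensor_tmul]
    exact GradedTensorProduct.tmul_one_mul_one_tmul K.part G.part _ _

lemma mem_indSubmodule_iff {f : G.Coord} : f ∈ ι.indSubmodule ↔
    ι.pullbackLeft (G.comulHom f) = GradedTensorProduct.includeRight K.part G.part f := by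
  rw [mem_indSubmodule, pullbackLeft_comulHom]
  exact ((GradedTensorProduct.of ℂ K.part G.part).injective.eq_iff).symm

lemma mul_mem_indSubmodule {f f' : G.Coord} (hf : f ∈ ι.indSubmodule)
    (hf' : f' ∈ ι.indSubmodule) : f * f' ∈ ι.indSubmodule := by
  rw [mem_indSubmodule_iff] at *
  rw [map_mul, map_mul, map_mul, hf, hf']

end ClosedEmbedding

/-! ### Matrix coefficients in homogeneous bases -/

section Coefficients

variable {G K : AlgSupergroup}

/-- A basis of a `G`-module made of homogeneous vectors. -/
structure HomogeneousBasis (M : G.SMod) (n : Type) where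
  basis : Module.Basis n ℂ M.carrier
  parity : n → ZMod 2
  mem : ∀ i, basis i ∈ M.part (parity i)

lemma exists_homogeneousBasis (M : G.SMod) [FiniteDimensional ℂ M.carrier] :
    ∃ (n : Type) (_ : Fintype n) (_ : DecidableEq n), Nonempty (HomogeneousBasis M n) := by
  have hint := DirectSum.Decomposition.isInternal M.part
  refine ⟨Σ i : ZMod 2, Fin (Module.finrank ℂ (M.part i)), inferInstance, inferInstance,
    ⟨hint.collectedBasis fun i => Module.finBasis ℂ (M.part i), Sigma.fst, fun i => ?_⟩⟩
  exact hint.collectedBasis_mem _ i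

/-- Scalar matrices, as matrices with entries in an algebra. -/
def scalarMatrix {m n : Type} (A : Type) [Ring A] [Algebra ℂ A] (P : Matrix m n ℂ) :
    Matrix m n A := P.map (algebraMap ℂ A)

lemma scalarMatrix_map {m n A B : Type} [Ring A] [Algebra ℂ A] [Ring B] [Algebra ℂ B]
    (P : Matrix m n ℂ) (f : A →ₐ[ℂ] B) : (scalarMatrix A P).map f = scalarMatrix B P := by
  ext i j; simp [scalarMatrix]

variable {n n' : Type} [Fintype n] [DecidableEq n] [Fintype n'] [DecidableEq n']

namespace HomogeneousBasis

variable {M N : G.SMod} (b : HomogeneousBasis M n) (b' : HomogeneousBasis N n')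

/-- The matrix coefficients `t` of a `G`-module, with `ρ b_i = ∑_j b_j ⊗ t_ji`. -/
def coeff : Matrix n n G.Coord := fun j i =>
  TensorProduct.lid ℂ G.Coord ((b.basis.coord j).rTensor G.Coord (M.coact (b.basis i)))

lemma sum_basis_tmul {E : Type} [AddCommGroup E] [Module ℂ E] (t : M.carrier ⊗[ℂ] E) :
    ∑ j, b.basis j ⊗ₜ[ℂ] TensorProduct.lid ℂ E ((b.basis.coord j).rTensor E t) = t := by
  induction t with
  | zero => simp
  | add x y hx hy => simp only [map_add, TensorProduct.tmul_add, Finset.sum_add_distrib, hx, hy]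
  | tmul v e =>
    simp only [LinearMap.rTensor_tmul, TensorProduct.lid_tmul, TensorProduct.tmul_smul,
      TensorProduct.smul_tmul', Module.Basis.coord_apply]
    rw [← TensorProduct.sum_tmul, b.basis.sum_repr]

lemma lid_coord_sum {E : Type} [AddCommGroup E] [Module ℂ E] (c : n → E) (j : n) :
    TensorProduct.lid ℂ E ((b.basis.coord j).rTensor E (∑ k, b.basis k ⊗ₜ[ℂ] c k)) = c j := by
  simp [Finsupp.single_apply]

/-- Tensors are determined by their coordinates in a basis of the left factor. -/
lemma sum_tmul_injective {E : Type} [AddCommGroup E] [Module ℂ E] {c c' : n → E}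
    (h : ∑ k, b.basis k ⊗ₜ[ℂ] c k = ∑ k, b.basis k ⊗ₜ[ℂ] c' k) : c = c' := by
  funext j
  rw [← b.lid_coord_sum c j, h, b.lid_coord_sum]

lemma coact_basis (i : n) : M.coact (b.basis i) = ∑ j, b.basis j ⊗ₜ[ℂ] b.coeff j i :=
  (b.sum_basis_tmul _).symm

lemma comul_coeff (j i : n) : Coalgebra.comul (R := ℂ) (b.coeff j i) =
    ∑ k, b.coeff j k ⊗ₜ[ℂ] b.coeff k i := by
  have h := LinearMap.congr_fun M.isCoaction.coassoc (b.basis i)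
  simp only [LinearMap.comp_apply, LinearEquiv.coe_coe, coact_basis, map_sum,
    LinearMap.rTensor_tmul, LinearMap.lTensor_tmul, TensorProduct.sum_tmul,
    TensorProduct.assoc_tmul] at h
  rw [Finset.sum_comm] at h
  simp only [← TensorProduct.tmul_sum] at h
  exact (congrFun (b.sum_tmul_injective h) j).symm

lemma counit_coeff (j i : n) :
    Coalgebra.counit (R := ℂ) (b.coeff j i) = (1 : Matrix n n ℂ) j i := by
  have h := LinearMap.congr_fun M.isCoaction.counit (b.basis i)
  simp only [LinearMap.comp_apply, LinearEquiv.coe_coe, coact_basis, map_sum,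
    LinearMap.lTensor_tmul, TensorProduct.rid_tmul, LinearMap.id_apply] at h
  have h' := congrArg (fun v => b.basis.repr v j) h
  simpa [Finsupp.single_apply, Matrix.one_apply, eq_comm] using h'

lemma coeff_mem (j i : n) : b.coeff j i ∈ G.part (b.parity j + b.parity i) := by
  apply mem_of_parityMap
  have h := M.map_parity_coact (b.basis i)
  rw [parityMap_of_mem M.part (b.mem i), map_smul, coact_basis, map_sum, Finset.smul_sum] at h
  have h1 : ∀ k, TensorProduct.map (parityMap M.part) (parityMap G.part)
      (b.basis k ⊗ₜ[ℂ] b.coeff k i) =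
      b.basis k ⊗ₜ[ℂ] (superSign (b.parity k) • parityMap G.part (b.coeff k i)) := fun k => by
    rw [TensorProduct.map_tmul, parityMap_of_mem M.part (b.mem k), TensorProduct.smul_tmul]
  simp only [h1, ← TensorProduct.tmul_smul] at h
  have h2 := congrFun (b.sum_tmul_injective h) j
  have h3 := congrArg (superSign (b.parity j) • ·) h2
  simp only [smul_smul, superSign_mul, CharTwo.add_self_eq_zero, superSign_zero, one_smul] at h3
  exact h3

/-- The matrix of the inverse group element. -/
def invCoeff : Matrix n n G.Coord := b.coeff.map G.antipode

lemma invCoeff_mem (j i : n) : b.invCoeff j i ∈ G.part (b.parity j + b.parity i) :=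
  G.antipode_even _ _ (b.coeff_mem j i)

lemma invCoeff_mul_coeff : b.invCoeff * b.coeff = 1 := by
  ext j i
  have h := LinearMap.congr_fun G.mul_antipode_rTensor_comul (b.coeff j i)
  simp only [LinearMap.comp_apply, comul_coeff, map_sum, LinearMap.rTensor_tmul,
    LinearMap.mul'_apply, counit_coeff, Algebra.linearMap_apply] at h
  rw [Matrix.mul_apply]
  refine h.trans ?_
  by_cases hij : j = i <;> simp [Matrix.one_apply, hij]

lemma coeff_mul_invCoeff : b.coeff * b.invCoeff = 1 := by
  ext j i
  have h := LinearMap.congr_fun G.mul_antipode_lTensor_comul (b.coeff j i)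
  simp only [LinearMap.comp_apply, comul_coeff, map_sum, LinearMap.lTensor_tmul,
    LinearMap.mul'_apply, counit_coeff, Algebra.linearMap_apply] at h
  rw [Matrix.mul_apply]
  refine h.trans ?_
  by_cases hij : j = i <;> simp [Matrix.one_apply, hij]

/-- The matrix of a product of group elements is the product of the matrices. -/
lemma coeff_map_comulHom : b.coeff.map G.comulHom =
    b.coeff.map (GradedTensorProduct.includeLeft G.part G.part) *
      b.coeff.map (GradedTensorProduct.includeRight G.part G.part) := by
  ext j i
  rw [Matrix.mul_apply, Matrix.map_apply, comulHom_apply, comul_coeff, map_sum]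
  exact Finset.sum_congr rfl fun k _ =>
    (GradedTensorProduct.tmul_one_mul_one_tmul G.part G.part _ _).symm

/-- A linear map is `G`-equivariant if and only if its matrix intertwines the matrix
coefficients. -/
lemma equivariant_iff (f : M.carrier →ₗ[ℂ] N.carrier) :
    N.coact ∘ₗ f = f.rTensor G.Coord ∘ₗ M.coact ↔
      b'.coeff * scalarMatrix G.Coord (LinearMap.toMatrix b.basis b'.basis f) =
        scalarMatrix G.Coord (LinearMap.toMatrix b.basis b'.basis f) * b.coeff := by
  have hf : ∀ i, f (b.basis i) =
      ∑ j, LinearMap.toMatrix b.basis b'.basis f j i • b'.basis j := fun i => by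
    simp only [LinearMap.toMatrix_apply]
    exact (b'.basis.sum_repr _).symm
  have h1 : ∀ i, N.coact (f (b.basis i)) = ∑ k, b'.basis k ⊗ₜ[ℂ]
      (b'.coeff * scalarMatrix G.Coord (LinearMap.toMatrix b.basis b'.basis f)) k i := fun i => by
    rw [hf, map_sum]
    simp only [map_smul, coact_basis, Finset.smul_sum, Matrix.mul_apply, TensorProduct.tmul_sum]
    rw [Finset.sum_comm]
    refine Finset.sum_congr rfl fun k _ => Finset.sum_congr rfl fun j _ => ?_
    rw [← TensorProduct.tmul_smul, Algebra.smul_def]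
    simp only [scalarMatrix, Matrix.map_apply]
    rw [Algebra.commutes]
  have h2 : ∀ i, f.rTensor G.Coord (M.coact (b.basis i)) = ∑ k, b'.basis k ⊗ₜ[ℂ]
      (scalarMatrix G.Coord (LinearMap.toMatrix b.basis b'.basis f) * b.coeff) k i := fun i => by
    rw [coact_basis, map_sum]
    simp only [LinearMap.rTensor_tmul, hf, TensorProduct.sum_tmul, Matrix.mul_apply,
      TensorProduct.tmul_sum]
    rw [Finset.sum_comm]
    refine Finset.sum_congr rfl fun k _ => Finset.sum_congr rfl fun j _ => ?_
    simp only [scalarMatrix, Matrix.map_apply]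
    rw [TensorProduct.smul_tmul, Algebra.smul_def]
  constructor
  · intro h
    ext k i
    have h3 := LinearMap.congr_fun h (b.basis i)
    rw [LinearMap.comp_apply, LinearMap.comp_apply, h1, h2] at h3
    exact congrFun (b'.sum_tmul_injective h3) k
  · intro h
    refine b.basis.ext fun i => ?_
    rw [LinearMap.comp_apply, LinearMap.comp_apply, h1, h2, h]

/-- A linear map is parity preserving if and only if its matrix is even. -/
lemma even_iff (f : M.carrier →ₗ[ℂ] N.carrier) :
    (∀ i, ∀ v ∈ M.part i, f v ∈ N.part i) ↔
      ∀ j i, b'.parity j ≠ b.parity i → LinearMap.toMatrix b.basis b'.basis f j i = 0 := by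
  have hcoord : ∀ (j : n') (k : ZMod 2) (w : N.carrier), w ∈ N.part k → b'.parity j ≠ k →
      b'.basis.repr w j = 0 := by
    intro j k w hw hne
    have h1 : b'.basis.repr (parityMap N.part w) j =
        superSign (b'.parity j) * b'.basis.repr w j := by
      conv_lhs => rw [← b'.basis.sum_repr w]
      simp only [map_sum, map_smul, parityMap_of_mem N.part (b'.mem _)]
      simp [Finsupp.single_apply, mul_comm]
    rw [parityMap_of_mem N.part hw, map_smul, Finsupp.smul_apply, smul_eq_mul] at h1
    have h2 : superSign k ≠ superSign (b'.parity j) := by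
      generalize b'.parity j = l at hne
      rcases zmod_two_cases k with rfl | rfl <;> rcases zmod_two_cases l with rfl | rfl <;>
        first | exact absurd rfl hne | norm_num [superSign_zero, superSign_one]
    have h3 : (superSign k - superSign (b'.parity j)) * b'.basis.repr w j = 0 := by
      rw [sub_mul, h1, sub_self]
    exact (mul_eq_zero.1 h3).resolve_left (sub_ne_zero.2 h2)
  constructor
  · intro h j i hne
    rw [LinearMap.toMatrix_apply]
    exact hcoord j _ _ (h _ _ (b.mem i)) hne
  · intro h
    suffices hc : ∀ v, parityMap N.part (f v) = f (parityMap M.part v) by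
      intro i v hv
      apply mem_of_parityMap
      rw [hc, parityMap_of_mem M.part hv, map_smul]
    have : parityMap N.part ∘ₗ f = f ∘ₗ parityMap M.part := by
      refine b.basis.ext fun i => ?_
      rw [LinearMap.comp_apply, LinearMap.comp_apply, parityMap_of_mem M.part (b.mem i), map_smul]
      apply parityMap_of_mem
      rw [← b'.basis.sum_repr (f (b.basis i))]
      refine Submodule.sum_mem _ fun j _ => ?_
      by_cases hj : b'.parity j = b.parity i
      · exact Submodule.smul_mem _ _ (hj ▸ b'.mem j)
      · have := h j i hj
        rw [LinearMap.toMatrix_apply] at this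
        rw [this, zero_smul]
        exact zero_mem _
    exact fun v => LinearMap.congr_fun this v

/-- The supertrace in a homogeneous basis. -/
lemma superTrace_eq (f : M.carrier →ₗ[ℂ] M.carrier) : superTrace M.part f =
    ∑ i, superSign (b.parity i) * LinearMap.toMatrix b.basis b.basis f i i := by
  have hσ : LinearMap.toMatrix b.basis b.basis (parityMap M.part) =
      Matrix.diagonal fun i => superSign (b.parity i) := by
    ext j i
    rw [LinearMap.toMatrix_apply, parityMap_of_mem M.part (b.mem i), map_smul]
    by_cases hij : j = i
    · subst hij; simp
    · simp [hij]
  rw [superTrace, LinearMap.trace_eq_matrix_trace ℂ b.basis,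
    LinearMap.toMatrix_comp b.basis b.basis b.basis, hσ, Matrix.trace]
  simp [Matrix.diagonal_mul]

/-- The same basis, for the restriction to a closed subgroup. -/
def restrict (ι : G.ClosedEmbedding K) : HomogeneousBasis (M.restrict ι) n :=
  ⟨b.basis, b.parity, b.mem⟩

lemma coeff_restrict (ι : G.ClosedEmbedding K) :
    (b.restrict ι).coeff = b.coeff.map ι.pullback := by
  ext j i
  have h := (b.restrict ι).coact_basis i
  have h' : (M.restrict ι).coact ((b.restrict ι).basis i) =
      ∑ j, (b.restrict ι).basis j ⊗ₜ[ℂ] ι.pullback (b.coeff j i) := by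
    change ι.pullback.toLinearMap.lTensor M.carrier (M.coact (b.basis i)) = _
    rw [coact_basis, map_sum]
    rfl
  exact congrFun ((b.restrict ι).sum_tmul_injective (h.symm.trans h')) j

end HomogeneousBasis

end Coefficients

/-! ### Conjugating a `K`-equivariant map by the elements of `G` -/

section Conjugation

variable {G K : AlgSupergroup} {n n' : Type} [Fintype n] [DecidableEq n] [Fintype n']
  [DecidableEq n'] {M N : G.SMod} (b : HomogeneousBasis M n) (b' : HomogeneousBasis N n')

/-- The matrix of the function `g ↦ g⁻¹ φ g` on `G`, for a linear map `φ : M → N` with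
matrix `P`. -/
def conjMatrix (P : Matrix n' n ℂ) : Matrix n' n G.Coord :=
  b'.invCoeff * scalarMatrix G.Coord P * b.coeff

lemma coeff_mul_conjMatrix (P : Matrix n' n ℂ) :
    b'.coeff * conjMatrix b b' P = scalarMatrix G.Coord P * b.coeff := by
  rw [conjMatrix, ← Matrix.mul_assoc, ← Matrix.mul_assoc, b'.coeff_mul_invCoeff, Matrix.one_mul]

lemma conjMatrix_sub (P Q : Matrix n' n ℂ) :
    conjMatrix b b' (P - Q) = conjMatrix b b' P - conjMatrix b b' Q := by
  have : scalarMatrix G.Coord (P - Q) = scalarMatrix G.Coord P - scalarMatrix G.Coord Q := by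
    ext i j; simp [scalarMatrix]
  rw [conjMatrix, this, Matrix.mul_sub, Matrix.sub_mul]
  rfl

/-- Conjugation does not change an equivariant map. -/
lemma conjMatrix_of_equivariant {P : Matrix n' n ℂ}
    (h : b'.coeff * scalarMatrix G.Coord P = scalarMatrix G.Coord P * b.coeff) :
    conjMatrix b b' P = scalarMatrix G.Coord P := by
  rw [conjMatrix, Matrix.mul_assoc, ← h, ← Matrix.mul_assoc, b'.invCoeff_mul_coeff,
    Matrix.one_mul]

lemma scalarMatrix_mul {l : Type} (A : Type) [Ring A] [Algebra ℂ A] (P : Matrix n' n ℂ)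
    (Q : Matrix n l ℂ) : scalarMatrix A (P * Q) = scalarMatrix A P * scalarMatrix A Q := by
  simp [scalarMatrix, Matrix.map_mul]

lemma conjMatrix_mul_conjMatrix (P : Matrix n' n ℂ) (Q : Matrix n n' ℂ) :
    conjMatrix b' b Q * conjMatrix b b' P = conjMatrix b b (Q * P) := by
  simp only [conjMatrix, scalarMatrix_mul]
  rw [← Matrix.mul_assoc, ← Matrix.mul_assoc, Matrix.mul_assoc _ b'.coeff, b'.coeff_mul_invCoeff,
    Matrix.mul_one, ← Matrix.mul_assoc]

lemma scalar_mem (c : ℂ) : algebraMap ℂ G.Coord c ∈ G.part 0 := by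
  rw [Algebra.algebraMap_eq_smul_one]
  exact Submodule.smul_mem _ _ G.one_mem_part

lemma scalarMatrix_mem {p' : n' → ZMod 2} {p : n → ZMod 2} {P : Matrix n' n ℂ}
    (hP : ∀ i j, p' i ≠ p j → P i j = 0) (i : n') (j : n) :
    scalarMatrix G.Coord P i j ∈ G.part (p' i + p j) := by
  by_cases h : p' i = p j
  · rw [h, CharTwo.add_self_eq_zero]
    exact scalar_mem _
  · simp [scalarMatrix, hP i j h]

lemma matrix_mul_mem {l : Type} {q : l → ZMod 2} {p' : n' → ZMod 2} {p : n → ZMod 2}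
    {e e' : ZMod 2} {Y : Matrix l n' G.Coord} {Z : Matrix n' n G.Coord}
    (hY : ∀ i j, Y i j ∈ G.part (q i + p' j + e)) (hZ : ∀ i j, Z i j ∈ G.part (p' i + p j + e'))
    (i : l) (j : n) : (Y * Z) i j ∈ G.part (q i + p j + (e + e')) := by
  rw [Matrix.mul_apply]
  refine Submodule.sum_mem _ fun k _ => ?_
  have h := G.mul_mem_part (hY i k) (hZ k j)
  have e1 : q i + p' k + e + (p' k + p j + e') = q i + p j + (e + e') + (p' k + p' k) := by ring
  rwa [e1, CharTwo.add_self_eq_zero, add_zero] at h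

lemma conjMatrix_mem {P : Matrix n' n ℂ} (hP : ∀ i j, b'.parity i ≠ b.parity j → P i j = 0)
    (i : n') (j : n) : conjMatrix b b' P i j ∈ G.part (b'.parity i + b.parity j) := by
  have h1 := matrix_mul_mem (G := G) (e := 0) (e' := 0) (q := b'.parity) (p' := b'.parity)
    (p := b.parity) (Y := b'.invCoeff) (Z := scalarMatrix G.Coord P)
    (fun i j => by simpa using b'.invCoeff_mem i j)
    (fun i j => by simpa using scalarMatrix_mem hP i j)
  have h2 := matrix_mul_mem (G := G) (e := 0 + 0) (e' := 0) (q := b'.parity) (p' := b.parity)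
    (p := b.parity) h1 (fun i j => by simpa using b.coeff_mem i j) i j
  simpa [conjMatrix] using h2

/-- The function `g ↦ g⁻¹ φ g` transforms under right translations by conjugation. -/
lemma coeff_mul_conjMatrix_map_comulHom (P : Matrix n' n ℂ) :
    b'.coeff.map (GradedTensorProduct.includeRight G.part G.part) *
        (conjMatrix b b' P).map G.comulHom =
      (conjMatrix b b' P).map (GradedTensorProduct.includeLeft G.part G.part) *
        b.coeff.map (GradedTensorProduct.includeRight G.part G.part) := by
  set iL := GradedTensorProduct.includeLeft G.part G.part
  set iR := GradedTensorProduct.includeRight G.part G.part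
  have h : b'.coeff.map iL * (b'.coeff.map iR * (conjMatrix b b' P).map G.comulHom) =
      b'.coeff.map iL * ((conjMatrix b b' P).map iL * b.coeff.map iR) := by
    rw [← Matrix.mul_assoc, ← b'.coeff_map_comulHom, ← Matrix.map_mul, coeff_mul_conjMatrix,
      ← Matrix.mul_assoc, ← Matrix.map_mul, coeff_mul_conjMatrix, Matrix.map_mul, Matrix.map_mul,
      scalarMatrix_map, scalarMatrix_map, b.coeff_map_comulHom, Matrix.mul_assoc]
  have hinv : b'.invCoeff.map iL * b'.coeff.map iL = 1 := by
    rw [← Matrix.map_mul, b'.invCoeff_mul_coeff, Matrix.map_one _ (map_zero _) (map_one _)]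
  have h' := congrArg (b'.invCoeff.map iL * ·) h
  simpa only [← Matrix.mul_assoc, hinv, Matrix.one_mul] using h'

/-- If `φ` is `K`-equivariant, then `g ↦ g⁻¹ φ g` is a function on the quotient of `G` by `K`. -/
lemma conjMatrix_mem_indSubmodule (ι : G.ClosedEmbedding K) {P : Matrix n' n ℂ}
    (hP : b'.coeff.map ι.pullback * scalarMatrix K.Coord P =
      scalarMatrix K.Coord P * b.coeff.map ι.pullback) (i : n') (j : n) :
    conjMatrix b b' P i j ∈ ι.indSubmodule := by
  rw [ι.mem_indSubmodule_iff]
  set iL := GradedTensorProduct.includeLeft K.part G.part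
  set iR := GradedTensorProduct.includeRight K.part G.part
  have hT : ∀ {n : Type} [Fintype n] [DecidableEq n] {M : G.SMod} (b : HomogeneousBasis M n),
      b.coeff.map (ι.pullbackLeft.comp G.comulHom) =
        (b.coeff.map ι.pullback).map iL * b.coeff.map iR := fun b => by
    have := congrArg (fun X => X.map ι.pullbackLeft) b.coeff_map_comulHom
    simp only [Matrix.map_mul, Matrix.map_map] at this
    refine this.trans ?_
    congr 1
    · ext i j; exact ι.pullbackLeft_includeLeft _
    · ext i j; exact ι.pullbackLeft_includeRight _
  set f := ι.pullbackLeft.comp G.comulHom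
  have h : b'.coeff.map f * (conjMatrix b b' P).map f =
      b'.coeff.map f * (conjMatrix b b' P).map iR := by
    rw [← Matrix.map_mul, coeff_mul_conjMatrix, hT b', Matrix.mul_assoc, ← Matrix.map_mul,
      coeff_mul_conjMatrix, Matrix.map_mul, Matrix.map_mul, hT b, scalarMatrix_map,
      scalarMatrix_map, ← scalarMatrix_map P iL, ← Matrix.mul_assoc, ← Matrix.mul_assoc,
      ← Matrix.map_mul, ← hP, Matrix.map_mul]
  have hinv : b'.invCoeff.map f * b'.coeff.map f = 1 := by
    rw [← Matrix.map_mul, b'.invCoeff_mul_coeff, Matrix.map_one _ (map_zero _) (map_one _)]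
  have h' := congrArg (b'.invCoeff.map f * ·) h
  simp only [← Matrix.mul_assoc, hinv, Matrix.one_mul] at h'
  exact congrFun (congrFun h' i) j

/-- Averaging a function with values in linear maps by an invariant even functional gives an
equivariant map. -/
lemma equivariant_of_invariant_functional (ι : G.ClosedEmbedding K) {φ : G.Coord →ₗ[ℂ] ℂ}
    (hφ : ∀ a ∈ G.part 1, φ a = 0)
    (hinv : ∀ f ∈ ι.indSubmodule, evalLeft φ (Coalgebra.comul (R := ℂ) f) = algebraMap ℂ _ (φ f))
    {P : Matrix n' n ℂ} (hP : ∀ i j, conjMatrix b b' P i j ∈ ι.indSubmodule) :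
    b'.coeff * scalarMatrix G.Coord ((conjMatrix b b' P).map φ) =
      scalarMatrix G.Coord ((conjMatrix b b' P).map φ) * b.coeff := by
  ext i j
  have h := congrFun (congrFun (coeff_mul_conjMatrix_map_comulHom b b' P) i) j
  have h' := congrArg (fun s => evalLeft φ ((GradedTensorProduct.of ℂ G.part G.part).symm s)) h
  simp only [Matrix.mul_apply, map_sum, Matrix.map_apply] at h'
  simp only [Matrix.mul_apply, scalarMatrix, Matrix.map_apply]
  refine Eq.trans ?_ (h'.trans ?_)
  · refine Finset.sum_congr rfl fun k _ => ?_
    rw [evalLeft_includeRight_mul hφ, comulHom_apply, LinearEquiv.symm_apply_apply,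
      hinv _ (hP k j)]
  · refine Finset.sum_congr rfl fun k _ => ?_
    have : GradedTensorProduct.includeLeft G.part G.part (conjMatrix b b' P i k) *
        GradedTensorProduct.includeRight G.part G.part (b.coeff k j) =
        GradedTensorProduct.of ℂ G.part G.part (conjMatrix b b' P i k ⊗ₜ b.coeff k j) :=
      GradedTensorProduct.tmul_one_mul_one_tmul G.part G.part _ _
    rw [this, LinearEquiv.symm_apply_apply, evalLeft_tmul, Algebra.smul_def]

/-- The supertrace of a matrix, indexed by a homogeneous basis. -/
def matrixSuperTrace (p : n → ZMod 2) (Z : Matrix n n G.Coord) : G.Coord :=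
  ∑ i, superSign (p i) • Z i i

/-- The supertrace of an even endomorphism is invariant under conjugation. -/
lemma matrixSuperTrace_conjMatrix {P : Matrix n n ℂ}
    (hP : ∀ i j, b.parity i ≠ b.parity j → P i j = 0) :
    matrixSuperTrace b.parity (conjMatrix b b P) =
      algebraMap ℂ G.Coord (∑ i, superSign (b.parity i) * P i i) := by
  have hcomm : ∀ i j k, superSign (b.parity i) • (b.invCoeff i j * scalarMatrix G.Coord P j k *
      b.coeff k i) = superSign (b.parity j) • (algebraMap ℂ G.Coord (P j k) *
        (b.coeff k i * b.invCoeff i j)) := by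
    intro i j k
    by_cases hjk : b.parity j = b.parity k
    · have h := G.supercomm _ _ _ (b.invCoeff_mem i j) _ (b.coeff_mem k i)
      have hs : superSign (b.parity i) * superSign ((b.parity i + b.parity j) *
          (b.parity k + b.parity i)) = superSign (b.parity j) := by
        rw [superSign_mul, ← hjk]
        congr 1
        generalize b.parity i = x
        generalize b.parity j = y
        revert x y; decide
      simp only [scalarMatrix, Matrix.map_apply]
      rw [← Algebra.commutes, mul_assoc, h, mul_smul_comm, smul_smul, hs]
    · simp [scalarMatrix, hP j k hjk]
  calc matrixSuperTrace b.parity (conjMatrix b b P)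
      = ∑ i, ∑ k, ∑ j, superSign (b.parity i) •
          (b.invCoeff i j * scalarMatrix G.Coord P j k * b.coeff k i) := by
        simp only [matrixSuperTrace, conjMatrix, Matrix.mul_apply, Finset.sum_mul,
          Finset.smul_sum]
    _ = ∑ j, ∑ k, superSign (b.parity j) • (algebraMap ℂ G.Coord (P j k) *
          ∑ i, b.coeff k i * b.invCoeff i j) := by
        simp only [hcomm, Finset.mul_sum, Finset.smul_sum]
        exact (Finset.sum_comm.trans
          (Finset.sum_congr rfl fun k _ => Finset.sum_comm)).trans Finset.sum_comm
    _ = _ := by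
        have h1 : ∀ k j, ∑ i, b.coeff k i * b.invCoeff i j = (1 : Matrix n n G.Coord) k j :=
          fun k j => by rw [← b.coeff_mul_invCoeff, Matrix.mul_apply]
        simp only [h1, Matrix.one_apply, mul_ite, mul_one, mul_zero,
          Finset.sum_ite_eq', Finset.mem_univ, if_true, map_sum, map_mul, Algebra.smul_def]

end Conjugation

/-! ### Infinitesimal translations and the vanishing of supertraces -/

namespace LieOdd

variable {G K : AlgSupergroup}

/-- The image in `Lie G` of an odd element of `Lie K`. -/
def pushforward (ι : G.ClosedEmbedding K) (x : K.LieOdd) : G.LieOdd where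
  toLin := x.toLin ∘ₗ ι.pullback.toLinearMap
  odd a ha := x.odd _ (ι.even 0 a ha)
  leibniz a b := by
    have h : ∀ c : G.Coord,
        Coalgebra.counit (R := ℂ) (ι.pullback c) = Coalgebra.counit (R := ℂ) c :=
      fun c => LinearMap.congr_fun ι.counit_comp c
    simp [x.leibniz, h]

variable (y : G.LieOdd)

/-- The derivation `f ↦ ∑ f₁ y(f₂)` of `ℂ[G]`. -/
def deriv : G.Coord →ₗ[ℂ] G.Coord := evalRight y.toLin ∘ₗ Coalgebra.comul

lemma deriv_mul (a c : G.Coord) :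
    y.deriv (a * c) = y.deriv a * parityMap G.part c + a * y.deriv c :=
  evalRight_comul_mul y a c

lemma deriv_algebraMap (c : ℂ) : y.deriv (algebraMap ℂ G.Coord c) = 0 := by
  rw [Algebra.algebraMap_eq_smul_one, map_smul, deriv, LinearMap.comp_apply, G.comul_one,
    evalRight_tmul, y.map_one, zero_smul, smul_zero]

/-- An invariant functional kills the image of every infinitesimal translation. -/
lemma functional_deriv {φ : G.Coord →ₗ[ℂ] ℂ} {f : G.Coord}
    (hf : evalLeft φ (Coalgebra.comul (R := ℂ) f) = algebraMap ℂ _ (φ f)) :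
    φ (y.deriv f) = 0 := by
  have h : ∀ t : G.Coord ⊗[ℂ] G.Coord, φ (evalRight y.toLin t) = y.toLin (evalLeft φ t) := by
    intro t
    induction t with
    | zero => simp
    | add s t hs ht => simp only [map_add, hs, ht]
    | tmul a c => simp [mul_comm]
  rw [deriv, LinearMap.comp_apply, h, hf, Algebra.algebraMap_eq_smul_one, map_smul, y.map_one,
    smul_zero]

end LieOdd

section Vanishing

variable {G : AlgSupergroup} {n n' : Type} [Fintype n] [DecidableEq n] [Fintype n']
  [DecidableEq n'] {M N : G.SMod} (b : HomogeneousBasis M n) (b' : HomogeneousBasis N n')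
  (y : G.LieOdd)

lemma map_deriv_mul {l : Type} (Y : Matrix l n' G.Coord) (Z : Matrix n' n G.Coord) :
    (Y * Z).map y.deriv =
      Y.map y.deriv * Z.map (parityMap G.part) + Y * Z.map y.deriv := by
  ext i j
  simp [Matrix.mul_apply, y.deriv_mul, Finset.sum_add_distrib]

lemma map_parityMap_mul {l : Type} (Y : Matrix l n' G.Coord) (Z : Matrix n' n G.Coord) :
    (Y * Z).map (parityMap G.part) = Y.map (parityMap G.part) * Z.map (parityMap G.part) := by
  ext i j
  simp [Matrix.mul_apply, parityMap_mul]

/-- Linear maps are linear over scalar matrices on the left. -/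
lemma map_scalarMatrix_mul {l : Type} (h : G.Coord →ₗ[ℂ] G.Coord) (X : Matrix l n' ℂ)
    (Z : Matrix n' n G.Coord) :
    (scalarMatrix G.Coord X * Z).map h = scalarMatrix G.Coord X * Z.map h := by
  ext i j
  simp [Matrix.mul_apply, scalarMatrix, ← Algebra.smul_def]

/-- Linear maps are linear over scalar matrices on the right. -/
lemma map_mul_scalarMatrix {l : Type} (h : G.Coord →ₗ[ℂ] G.Coord) (X : Matrix n' n ℂ)
    (Z : Matrix l n' G.Coord) :
    (Z * scalarMatrix G.Coord X).map h = Z.map h * scalarMatrix G.Coord X := by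
  ext i j
  simp [Matrix.mul_apply, scalarMatrix, ← Algebra.commutes, ← Algebra.smul_def]

lemma HomogeneousBasis.coeff_map_deriv :
    b.coeff.map y.deriv = b.coeff * scalarMatrix G.Coord (b.coeff.map y.toLin) := by
  ext i j
  simp [Matrix.mul_apply, scalarMatrix, LieOdd.deriv, b.comul_coeff, ← Algebra.commutes,
    ← Algebra.smul_def]

/-- The derivative of the function `g ↦ g⁻¹ φ g` is a supercommutator with the matrix of `y`. -/
lemma conjMatrix_map_deriv (P : Matrix n' n ℂ) :
    (conjMatrix b b' P).map y.deriv =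
      conjMatrix b b' P * scalarMatrix G.Coord (b.coeff.map y.toLin) -
        scalarMatrix G.Coord (b'.coeff.map y.toLin) *
          (conjMatrix b b' P).map (parityMap G.part) := by
  have h := congrArg (fun Z => Z.map y.deriv) (coeff_mul_conjMatrix b b' P)
  have h0 : (scalarMatrix G.Coord P).map y.deriv = 0 := by
    ext i j; simp [scalarMatrix, y.deriv_algebraMap]
  simp only [map_deriv_mul, h0, Matrix.zero_mul, zero_add, HomogeneousBasis.coeff_map_deriv] at h
  rw [← Matrix.mul_assoc (scalarMatrix G.Coord P), ← coeff_mul_conjMatrix b b', Matrix.mul_assoc,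
    Matrix.mul_assoc, ← Matrix.mul_add] at h
  have h' := congrArg (b'.invCoeff * ·) h
  simp only [← Matrix.mul_assoc, b'.invCoeff_mul_coeff, Matrix.one_mul] at h'
  exact eq_sub_of_add_eq' h'

lemma mem_part_of_odd_map {I : Submodule ℂ G.Coord} {h : G.Coord →ₗ[ℂ] G.Coord}
    (hodd : ∀ f ∈ I, h (parityMap G.part f) = -parityMap G.part (h f)) {i : ZMod 2} {f : G.Coord}
    (hf : f ∈ I) (hfi : f ∈ G.part i) : h f ∈ G.part (i + 1) := by
  apply mem_of_parityMap
  have := hodd f hf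
  rw [parityMap_of_mem G.part hfi, map_smul] at this
  rw [← superSign_mul, superSign_one, mul_neg_one, neg_smul, this, neg_neg]

/-- Suppose that a subalgebra `I` of functions carries an invariant functional `φ` and that the
derivation `y` of `I` is contractible relative to the constants. If all `g⁻¹ φ₁ g` have average
zero, then `φ₁` is orthogonal to all `φ₂` for the supertrace form. Here `P` and `Q` are the matrices
of `φ₁` and `φ₂`. The function `str (g⁻¹ φ₂ φ₁ g)` is constant; up to supercommutators with the
matrix of `y`, it is the derivative of the supertrace of `Ψ * h Φ`, where `Φ = g⁻¹ φ₁ g` and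
`Ψ = g⁻¹ φ₂ g`; and `φ` kills derivatives. -/
lemma superTrace_eq_zero {I : Submodule ℂ G.Coord} (hmul : ∀ f ∈ I, ∀ f' ∈ I, f * f' ∈ I)
    {φ : G.Coord →ₗ[ℂ] ℂ} (hφ1 : φ 1 = 1)
    (hinv : ∀ f ∈ I, evalLeft φ (Coalgebra.comul (R := ℂ) f) = algebraMap ℂ _ (φ f))
    {h : G.Coord →ₗ[ℂ] G.Coord} (hI : ∀ f ∈ I, h f ∈ I)
    (hodd : ∀ f ∈ I, h (parityMap G.part f) = -parityMap G.part (h f))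
    (hhom : ∀ f ∈ I, y.deriv (h f) + h (y.deriv f) = f - algebraMap ℂ _ (φ f))
    {P : Matrix n' n ℂ} (hP : ∀ i j, b'.parity i ≠ b.parity j → P i j = 0)
    (hPI : ∀ i j, conjMatrix b b' P i j ∈ I) (hP0 : ∀ i j, φ (conjMatrix b b' P i j) = 0)
    {Q : Matrix n n' ℂ} (hQ : ∀ i j, b.parity i ≠ b'.parity j → Q i j = 0)
    (hQI : ∀ i j, conjMatrix b' b Q i j ∈ I) :
    ∑ i, superSign (b.parity i) * (Q * P) i i = 0 := by
  set Φ := conjMatrix b b' P with hΦ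
  set Ψ := conjMatrix b' b Q with hΨ
  set X := b.coeff.map y.toLin with hX
  set Z := Φ.map h with hZ
  set W := Ψ * Z with hW
  have hZmem : ∀ i j, Z i j ∈ G.part (b'.parity i + b.parity j + 1) := fun i j =>
    mem_part_of_odd_map hodd (hPI i j) (conjMatrix_mem b b' hP i j)
  have hWmem : ∀ i j, W i j ∈ G.part (b.parity i + b.parity j + 1) := fun i j => by
    have := matrix_mul_mem (G := G) (e := 0) (e' := 1) (q := b.parity) (p' := b'.parity)
      (p := b.parity) (Y := Ψ) (Z := Z)
      (fun i j => by simpa using conjMatrix_mem b' b hQ i j) hZmem i j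
    simpa using this
  have hWI : ∀ i j, W i j ∈ I := fun i j => by
    rw [hW, Matrix.mul_apply]
    exact Submodule.sum_mem _ fun k _ => hmul _ (hQI i k) _ (hI _ (hPI k j))
  have hZ' : Z.map y.deriv = Φ - Z * scalarMatrix G.Coord X -
      scalarMatrix G.Coord (b'.coeff.map y.toLin) * Z.map (parityMap G.part) := by
    have h1 : Z.map y.deriv = Φ - (Φ.map y.deriv).map h := by
      ext i j
      have := hhom _ (hPI i j)
      rw [hP0 i j, map_zero, sub_zero] at this
      exact eq_sub_of_add_eq this
    have h2 : (Φ.map (parityMap G.part)).map h = -Z.map (parityMap G.part) := by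
      ext i j
      exact hodd _ (hPI i j)
    have h3 : ∀ A B : Matrix n' n G.Coord, (A - B).map h = A.map h - B.map h := fun A B => by
      ext i j; simp
    rw [h1, conjMatrix_map_deriv, h3, map_mul_scalarMatrix, map_scalarMatrix_mul, h2,
      Matrix.mul_neg]
    abel
  have hW' : W.map y.deriv = Ψ * Φ - W * scalarMatrix G.Coord X -
      scalarMatrix G.Coord X * W.map (parityMap G.part) := by
    rw [hW, map_deriv_mul, hZ', hΨ, conjMatrix_map_deriv, ← hΨ, map_parityMap_mul]
    simp only [Matrix.sub_mul, Matrix.mul_sub, Matrix.mul_assoc]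
    abel
  have hX0 : ∀ i j, b.parity i = b.parity j → X i j = 0 := fun i j hij =>
    y.odd _ (by have := b.coeff_mem i j; rwa [hij, CharTwo.add_self_eq_zero] at this)
  -- `W` is odd, so the supercommutator with the odd matrix `X` has supertrace zero.
  have hstr : matrixSuperTrace b.parity (W * scalarMatrix G.Coord X +
      scalarMatrix G.Coord X * W.map (parityMap G.part)) = 0 := by
    have h1 : ∀ i j, superSign (b.parity i) • (W i j * scalarMatrix G.Coord X j i) +
        superSign (b.parity j) •
          (scalarMatrix G.Coord X j i * W.map (parityMap G.part) i j) = 0 := by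
      intro i j
      by_cases hij : b.parity j = b.parity i
      · simp [scalarMatrix, hX0 j i hij]
      · have hs : superSign (b.parity i + b.parity j + 1) = 1 ∧
            superSign (b.parity i) + superSign (b.parity j) = 0 := by
          generalize b.parity i = x at hij
          generalize b.parity j = z at hij
          rcases zmod_two_cases x with rfl | rfl <;> rcases zmod_two_cases z with rfl | rfl
          · exact absurd rfl hij
          · rw [show (0 + 1 + 1 : ZMod 2) = 0 by decide]; norm_num [superSign_zero, superSign_one]
          · rw [show (1 + 0 + 1 : ZMod 2) = 0 by decide]; norm_num [superSign_zero, superSign_one]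
          · exact absurd rfl hij
        rw [Matrix.map_apply, parityMap_of_mem G.part (hWmem i j), hs.1, one_smul]
        simp only [scalarMatrix, Matrix.map_apply]
        rw [Algebra.commutes, ← add_smul, hs.2, zero_smul]
    simp only [matrixSuperTrace, Matrix.add_apply, Matrix.mul_apply, smul_add, Finset.smul_sum,
      Finset.sum_add_distrib]
    rw [Finset.sum_comm (f := fun i j => superSign (b.parity i) •
      (scalarMatrix G.Coord X i j * W.map (parityMap G.part) j i)), ← Finset.sum_add_distrib]
    refine Finset.sum_eq_zero fun i _ => ?_
    rw [← Finset.sum_add_distrib]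
    exact Finset.sum_eq_zero fun j _ => h1 i j
  have hfin : y.deriv (matrixSuperTrace b.parity W) =
      algebraMap ℂ G.Coord (∑ i, superSign (b.parity i) * (Q * P) i i) := by
    have hQP : ∀ i j, b.parity i ≠ b.parity j → (Q * P) i j = 0 := by
      intro i j hij
      rw [Matrix.mul_apply]
      refine Finset.sum_eq_zero fun k _ => ?_
      by_cases hk : b.parity i = b'.parity k
      · rw [hP k j (hk ▸ hij), mul_zero]
      · rw [hQ i k hk, zero_mul]
    rw [← matrixSuperTrace_conjMatrix b hQP, ← conjMatrix_mul_conjMatrix b b', ← hΦ, ← hΨ]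
    have h1 : Ψ * Φ = W.map y.deriv + (W * scalarMatrix G.Coord X +
        scalarMatrix G.Coord X * W.map (parityMap G.part)) := by rw [hW']; abel
    have h2 : ∀ A B : Matrix n n G.Coord, matrixSuperTrace b.parity (A + B) =
        matrixSuperTrace b.parity A + matrixSuperTrace b.parity B := fun A B => by
      simp [matrixSuperTrace, Finset.sum_add_distrib]
    rw [h1, h2, hstr, add_zero]
    simp [matrixSuperTrace]
  have hmem : matrixSuperTrace b.parity W ∈ I :=
    Submodule.sum_mem _ fun i _ => Submodule.smul_mem _ _ (hWI i i)
  have := y.functional_deriv (hinv _ hmem)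
  rw [hfin, Algebra.algebraMap_eq_smul_one, map_smul, hφ1, smul_eq_mul, mul_one] at this
  exact this

end Vanishing

/-! ### Contracting the functions on the quotient -/

section Operators

variable {G : AlgSupergroup}

/-- The operator `v ↦ ∑ v₀ ξ(v₁)` on a `G`-module defined by a functional on `ℂ[G]`. -/
def functionalAct (ξ : G.Coord →ₗ[ℂ] ℂ) (M : G.SMod) : M.carrier →ₗ[ℂ] M.carrier :=
  (TensorProduct.rid ℂ M.carrier).toLinearMap ∘ₗ ξ.lTensor M.carrier ∘ₗ M.coact

lemma coact_functionalAct (ξ : G.Coord →ₗ[ℂ] ℂ) (M : G.SMod) (v : M.carrier) :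
    M.coact (functionalAct ξ M v) =
      (evalRight ξ ∘ₗ Coalgebra.comul).lTensor M.carrier (M.coact v) := by
  have h := LinearMap.congr_fun M.isCoaction.coassoc v
  simp only [LinearMap.comp_apply, LinearEquiv.coe_coe] at h
  let E : M.carrier ⊗[ℂ] (G.Coord ⊗[ℂ] G.Coord) →ₗ[ℂ] M.carrier ⊗[ℂ] G.Coord :=
    (evalRight ξ).lTensor M.carrier
  have h1 : ∀ t : M.carrier ⊗[ℂ] G.Coord,
      E (TensorProduct.assoc ℂ M.carrier G.Coord G.Coord (M.coact.rTensor G.Coord t)) =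
        M.coact (TensorProduct.rid ℂ M.carrier (ξ.lTensor M.carrier t)) := by
    intro t
    induction t with
    | zero => simp
    | add s t hs ht => simp only [map_add, hs, ht]
    | tmul m a =>
      simp only [LinearMap.rTensor_tmul, LinearMap.lTensor_tmul, TensorProduct.rid_tmul, map_smul]
      induction M.coact m with
      | zero => simp
      | add x y hx hy => simp only [map_add, TensorProduct.add_tmul, smul_add, hx, hy]
      | tmul m b => simp [E]
  have h2 := congrArg E h
  rw [h1] at h2
  refine h2.trans ?_
  rw [← LinearMap.comp_apply, ← LinearMap.lTensor_comp]

lemma coact_injective (M : G.SMod) : Function.Injective M.coact := fun v w h => by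
  have hv := LinearMap.congr_fun M.isCoaction.counit v
  have hw := LinearMap.congr_fun M.isCoaction.counit w
  simp only [LinearMap.comp_apply] at hv hw
  rw [h, hw] at hv
  exact hv.symm

/-- A functional acting semisimply on `ℂ[G]` acts semisimply on every `G`-module, since the
coaction embeds the module into a sum of copies of `ℂ[G]`. -/
lemma isSemisimple_functionalAct {ξ : G.Coord →ₗ[ℂ] ℂ}
    (hξ : Module.End.IsSemisimple (R := ℂ) (M := G.Coord) (evalRight ξ ∘ₗ Coalgebra.comul))
    (M : G.SMod) :
    Module.End.IsSemisimple (R := ℂ) (M := M.carrier) (functionalAct ξ M) :=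
  isSemisimple_of_intertwiner_injective M.coact (coact_functionalAct ξ M) (coact_injective M)
    (isSemisimple_lTensor hξ M.carrier)

namespace LieOdd

variable (x : G.LieOdd) (M : G.SMod)

lemma act_apply (v : M.carrier) :
    x.act M v = functionalAct x.toLin M (parityMap M.part v) := rfl

lemma functionalAct_parityMap (v : M.carrier) :
    functionalAct x.toLin M (parityMap M.part v) =
      -parityMap M.part (functionalAct x.toLin M v) := by
  simp only [functionalAct, LinearMap.comp_apply, ← M.map_parity_coact]
  induction M.coact v with
  | zero => simp
  | add s t hs ht => simp only [map_add, hs, ht]; abel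
  | tmul m c =>
    induction c using part_induction G.part with
    | hadd c c' h h' => simp only [TensorProduct.tmul_add, map_add, h, h']; abel
    | h i c hc =>
      rcases zmod_two_cases i with rfl | rfl
      · simp [parityMap_of_mem G.part hc, x.odd c hc]
      · simp [parityMap_of_mem G.part hc, superSign_one]

lemma functionalAct_selfBracket (v : M.carrier) :
    functionalAct x.selfBracket M v =
      (-2 : ℂ) • functionalAct x.toLin M (functionalAct x.toLin M v) := by
  have h := coact_functionalAct x.toLin M v
  change TensorProduct.rid ℂ M.carrier (x.selfBracket.lTensor M.carrier (M.coact v)) =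
    (-2 : ℂ) • TensorProduct.rid ℂ M.carrier (x.toLin.lTensor M.carrier
      (M.coact (functionalAct x.toLin M v)))
  rw [h]
  have key : ∀ t : M.carrier ⊗[ℂ] G.Coord, TensorProduct.rid ℂ M.carrier
      (x.selfBracket.lTensor M.carrier t) = (-2 : ℂ) • TensorProduct.rid ℂ M.carrier
        (((x.toLin ∘ₗ evalRight x.toLin) ∘ₗ Coalgebra.comul).lTensor M.carrier t) := by
    intro t
    induction t with
    | zero => simp
    | add s t hs ht => simp only [map_add, smul_add, hs, ht]
    | tmul m a =>
      simp only [LinearMap.lTensor_tmul, TensorProduct.rid_tmul, selfBracket,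
        LinearMap.smul_apply, smul_assoc]
      congr 2
      simp only [LinearMap.comp_apply]
      induction Coalgebra.comul (R := ℂ) a with
      | zero => simp
      | add s t hs ht => simp only [map_add, hs, ht]
      | tmul b c => simp [mul_comm]
  rw [key, ← LinearMap.comp_apply (LinearMap.lTensor _ _) (LinearMap.lTensor _ _),
    ← LinearMap.lTensor_comp, LinearMap.comp_assoc]

/-- The square of a homological element splits off its kernel in every `G`-module. -/
lemma isCompl_ker_range_sq (hx : x.IsHomological) :
    IsCompl (LinearMap.ker (functionalAct x.toLin M ∘ₗ functionalAct x.toLin M))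
      (LinearMap.range (functionalAct x.toLin M ∘ₗ functionalAct x.toLin M)) := by
  apply isCompl_ker_range_of_isSemisimple
  have h := isSemisimple_functionalAct (ξ := x.selfBracket) hx M
  have h2 : functionalAct x.selfBracket M =
      (-2 : ℂ) • (functionalAct x.toLin M ∘ₗ functionalAct x.toLin M) := by
    ext v
    exact x.functionalAct_selfBracket M v
  rw [h2] at h
  exact (Module.End.IsSemisimple_smul_iff (by norm_num)).1 h

end LieOdd

end Operators

section Splitting

variable {G K : AlgSupergroup} (ι : G.ClosedEmbedding K)

lemma parityMap_purelyEven (c : ℂ) : parityMap (purelyEven ℂ) c = c := by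
  rw [parityMap_of_mem (purelyEven ℂ) (i := 0) (by simp [purelyEven]), superSign_zero, one_smul]

/-- The inclusion of the functions on the quotient into the functions on `G`. -/
def indIncl : ι.ind.carrier →ₗ[ℂ] G.Coord := ι.indSubmodule.subtype

/-- The constant function `1`, as a function on the quotient. -/
def indOne : ι.ind.carrier := (⟨1, ι.one_mem_indSubmodule⟩ : ι.indSubmodule)

lemma indIncl_injective : Function.Injective (indIncl ι) := ι.indSubmodule.injective_subtype

lemma indIncl_mem (v : ι.ind.carrier) : indIncl ι v ∈ ι.indSubmodule := Subtype.property _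

lemma exists_indIncl {f : G.Coord} (hf : f ∈ ι.indSubmodule) : ∃ v, indIncl ι v = f :=
  ⟨(⟨f, hf⟩ : ι.indSubmodule), rfl⟩

lemma parityMap_indIncl (v : ι.ind.carrier) :
    parityMap G.part (indIncl ι v) = indIncl ι (parityMap ι.ind.part v) :=
  parityMap_comm ι.ind.part G.part (indIncl ι) (fun _ _ h => h) v

lemma comul_indIncl (v : ι.ind.carrier) : Coalgebra.comul (R := ℂ) (indIncl ι v) =
    (indIncl ι).rTensor G.Coord (ι.ind.coact v) :=
  (SMod.rTensor_subCoact (SMod.regular G) ι.indSubmodule ι.isSubcomodule_indSubmodule v).symm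

/-- A `G`-equivariant left inverse of the inclusion of the constants, as an invariant functional. -/
lemma exists_retraction (h : IsSplitMono ι.unit) : ∃ r : ι.ind.carrier →ₗ[ℂ] ℂ,
    r (indOne ι) = 1 ∧ (∀ v, r (parityMap ι.ind.part v) = r v) ∧
      ∀ v, r.rTensor G.Coord (ι.ind.coact v) = r v ⊗ₜ[ℂ] (1 : G.Coord) := by
  obtain ⟨⟨r₀, hr₀⟩⟩ := h
  let r : ι.ind.carrier →ₗ[ℂ] ℂ := r₀.toLin
  refine ⟨r, ?_, fun v => ?_, fun v => ?_⟩
  · have h1 : r ((1 : ℂ) • indOne ι) = 1 :=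
      LinearMap.congr_fun (congrArg SMod.Hom.toLin hr₀) (1 : ℂ)
    rwa [one_smul] at h1
  · have h1 := parityMap_comm ι.ind.part (purelyEven ℂ) r r₀.even v
    exact h1.symm.trans (parityMap_purelyEven _)
  · exact (LinearMap.congr_fun r₀.equivariant v).symm

variable {r : ι.ind.carrier →ₗ[ℂ] ℂ}

/-- An invariant functional on `ℂ[G/K]` extends to an even functional on `ℂ[G]`. -/
lemma exists_functional (hr : ∀ v, r (parityMap ι.ind.part v) = r v)
    (hinv : ∀ v, r.rTensor G.Coord (ι.ind.coact v) = r v ⊗ₜ[ℂ] (1 : G.Coord)) :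
    ∃ φ : G.Coord →ₗ[ℂ] ℂ, (∀ a ∈ G.part 1, φ a = 0) ∧
      (∀ v : ι.ind.carrier, φ (indIncl ι v) = r v) ∧
      ∀ f ∈ ι.indSubmodule,
        evalLeft φ (Coalgebra.comul (R := ℂ) f) = algebraMap ℂ _ (φ f) := by
  obtain ⟨φ₀, hφ₀⟩ := LinearMap.exists_extend (p := ι.indSubmodule) (V' := ℂ) r
  have h0 : ∀ v : ι.ind.carrier, φ₀ (indIncl ι v) = r v :=
    fun v => LinearMap.congr_fun hφ₀ v
  -- The extension is made even by composing with the even projection.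
  have h1 : ∀ v : ι.ind.carrier, (φ₀ ∘ₗ superProj G.part 0) (indIncl ι v) = r v := fun v => by
    have e : superProj G.part 0 (indIncl ι v) = (2 : ℂ)⁻¹ •
        (indIncl ι v + indIncl ι (parityMap ι.ind.part v)) := by
      rw [← parityMap_indIncl]
      nth_rewrite 2 [← superProj_add G.part (indIncl ι v)]
      simp only [parityMap, LinearMap.sub_apply]
      module
    rw [LinearMap.comp_apply, e, map_smul, map_add, h0, h0, hr, ← two_smul ℂ, smul_smul]
    norm_num
  refine ⟨φ₀ ∘ₗ superProj G.part 0, fun a ha => ?_, h1, fun f hf => ?_⟩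
  · rw [LinearMap.comp_apply, superProj_of_mem G.part 0 ha]
    simp
  · obtain ⟨v, rfl⟩ := exists_indIncl ι hf
    have h2 : ∀ t : ι.ind.carrier ⊗[ℂ] G.Coord, evalLeft (φ₀ ∘ₗ superProj G.part 0)
        ((indIncl ι).rTensor G.Coord t) = TensorProduct.lid ℂ G.Coord (r.rTensor G.Coord t) := by
      intro t
      induction t with
      | zero => simp only [map_zero]
      | add s t hs ht => simp only [map_add, hs, ht]
      | tmul v a =>
        rw [LinearMap.rTensor_tmul, evalLeft_tmul, h1, LinearMap.rTensor_tmul,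
          TensorProduct.lid_tmul]
    rw [comul_indIncl, h2, hinv, TensorProduct.lid_tmul, Algebra.algebraMap_eq_smul_one, h1]

lemma deriv_indIncl (x : K.LieOdd) (v : (ι.ind.restrict ι).carrier) :
    (x.pushforward ι).deriv (indIncl ι v) =
      indIncl ι (functionalAct x.toLin (ι.ind.restrict ι) v) := by
  have h : ∀ t : ι.ind.carrier ⊗[ℂ] G.Coord, evalRight (x.pushforward ι).toLin
      ((indIncl ι).rTensor G.Coord t) = indIncl ι
        (TensorProduct.rid ℂ ι.ind.carrier (x.toLin.lTensor ι.ind.carrier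
          (ι.pullback.toLinearMap.lTensor ι.ind.carrier t))) := by
    intro t
    induction t with
    | zero => simp only [map_zero]
    | add s t hs ht => simp only [map_add, hs, ht]
    | tmul v a =>
      simp only [LinearMap.rTensor_tmul, evalRight_tmul, LinearMap.lTensor_tmul,
        TensorProduct.rid_tmul, map_smul]
      rfl
  exact (congrArg _ (comul_indIncl ι v)).trans (h _)

end Splitting

/-- If `DS_x V` is one-dimensional, then `x` is exact on the kernel of an `x`-invariant functional
that does not vanish on all `x`-invariant vectors. -/
lemma LieOdd.mem_range_of_functional {K : AlgSupergroup} (x : K.LieOdd) (V : K.SMod)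
    {r : V.carrier →ₗ[ℂ] ℂ} {u : V.carrier} (hr1 : r u = 1)
    (hrx : ∀ v, r (functionalAct x.toLin V v) = 0) (hx1 : functionalAct x.toLin V u = 0)
    (e : x.DS V ≃ₗ[ℂ] ℂ) (v : V.carrier) (hv : functionalAct x.toLin V v = 0) (hrv : r v = 0) :
    v ∈ LinearMap.range (functionalAct x.toLin V) := by
  have hker : ∀ w : V.carrier, functionalAct x.toLin V w = 0 → w ∈ LinearMap.ker (x.act V) := by
    intro w hw
    rw [LinearMap.mem_ker, x.act_apply, x.functionalAct_parityMap, hw, map_zero, neg_zero]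
  let π := Submodule.mkQ ((LinearMap.range (x.act V)).comap (LinearMap.ker (x.act V)).subtype)
  -- The class of `u` spans the line `DS_x V`.
  have hu : e (π ⟨u, hker u hx1⟩) ≠ 0 := by
    intro h0
    have h2 : π ⟨u, hker u hx1⟩ = 0 := by simpa using h0
    obtain ⟨w, hw⟩ := (Submodule.Quotient.mk_eq_zero _).1 h2
    have h3 : functionalAct x.toLin V (parityMap V.part w) = u := hw
    rw [← h3, hrx] at hr1
    exact zero_ne_one hr1
  obtain ⟨c, hc⟩ : ∃ c : ℂ, e (π ⟨v, hker v hv⟩) = c * e (π ⟨u, hker u hx1⟩) :=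
    ⟨e (π ⟨v, hker v hv⟩) / e (π ⟨u, hker u hx1⟩), (div_mul_cancel₀ _ hu).symm⟩
  have h4 : π (⟨v, hker v hv⟩ - c • ⟨u, hker u hx1⟩) = 0 := by
    apply e.injective
    rw [map_sub, map_smul, map_sub, map_smul, hc, smul_eq_mul, sub_self, map_zero]
  obtain ⟨w, hw⟩ := (Submodule.Quotient.mk_eq_zero _).1 h4
  have hw' : functionalAct x.toLin V (parityMap V.part w) = v - c • u := hw
  have h5 : c = 0 := by
    have := hrx (parityMap V.part w)
    rw [hw', map_sub, map_smul, hrv, hr1] at this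
    simpa using this
  rw [h5, zero_smul, sub_zero] at hw'
  exact ⟨_, hw'⟩

/-- For a proper pair there are an invariant even functional `φ` on the functions on the quotient,
normalized on the constants, and an odd contracting homotopy, relative to `φ`, for an infinitesimal
translation. -/
lemma ClosedEmbedding.IsProper.exists_contraction {G K : AlgSupergroup} {ι : G.ClosedEmbedding K}
    (hι : ι.IsProper) : ∃ (y : G.LieOdd) (φ : G.Coord →ₗ[ℂ] ℂ) (h : G.Coord →ₗ[ℂ] G.Coord),
      (∀ a ∈ G.part 1, φ a = 0) ∧ φ 1 = 1 ∧
      (∀ f ∈ ι.indSubmodule,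
        evalLeft φ (Coalgebra.comul (R := ℂ) f) = algebraMap ℂ _ (φ f)) ∧
      (∀ f ∈ ι.indSubmodule, h f ∈ ι.indSubmodule) ∧
      (∀ f ∈ ι.indSubmodule, h (parityMap G.part f) = -parityMap G.part (h f)) ∧
      ∀ f ∈ ι.indSubmodule, y.deriv (h f) + h (y.deriv f) = f - algebraMap ℂ _ (φ f) := by
  obtain ⟨-, ⟨-, hs⟩, x, hx, e, -⟩ := hι
  obtain ⟨r, hr1, hrσ, hrinv⟩ := exists_retraction ι hs
  obtain ⟨φ, hφodd, hφr, hφinv⟩ := exists_functional ι hrσ hrinv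
  let y := x.pushforward ι
  let V := ι.ind.restrict ι
  let R : V.carrier →ₗ[ℂ] V.carrier := functionalAct x.toLin V
  let r' : V.carrier →ₗ[ℂ] ℂ := r
  let u : V.carrier := indOne ι
  let j : V.carrier →ₗ[ℂ] G.Coord := indIncl ι
  have hφr' : ∀ v : V.carrier, φ (j v) = r' v := hφr
  have hju : j u = 1 := rfl
  have hr'u : r' u = 1 := hr1
  have hφ1 : φ 1 = 1 := by rw [← hju, hφr', hr'u]
  have hd : ∀ v : V.carrier, y.deriv (j v) = j (R v) := deriv_indIncl ι x
  have hr'R : ∀ v, r' (R v) = 0 := fun v => by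
    rw [← hφr', ← hd]
    exact y.functional_deriv (hφinv _ (indIncl_mem ι v))
  have hRu : R u = 0 := by
    apply indIncl_injective ι
    change j (R u) = j 0
    rw [map_zero, ← hd, hju, ← map_one (algebraMap ℂ G.Coord), y.deriv_algebraMap]
  let E : V.carrier →ₗ[ℂ] V.carrier := (LinearMap.toSpanSingleton ℂ V.carrier u) ∘ₗ r'
  have hE : ∀ v, E v = r' v • u := fun v => rfl
  obtain ⟨h₀, hh₀⟩ := exists_homotopy R E (x.isCompl_ker_range_sq V hx)
    (fun v => by rw [hE, map_smul, hRu, smul_zero])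
    (fun v => by rw [hE, hr'R, zero_smul])
    (fun v => by rw [hE, hE, map_smul, hr'u, smul_eq_mul, mul_one])
    (fun v hv hv' => x.mem_range_of_functional V hr'u hr'R hRu e v hv (by
      rw [hE] at hv'
      have := congrArg r' hv'
      rwa [map_smul, hr'u, smul_eq_mul, mul_one, map_zero] at this))
  -- Only the odd part of the homotopy matters, because `R` is odd.
  let σ : V.carrier →ₗ[ℂ] V.carrier := parityMap V.part
  have hσσ : ∀ v, σ (σ v) = v := parityMap_parityMap V.part
  have hRσ : ∀ v, R (σ v) = -σ (R v) := x.functionalAct_parityMap V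
  have hσE : ∀ v, σ (E (σ v)) = E v := fun v => by
    have h1 : σ u = u := parityMap_of_mem V.part (i := 0) (v := u) G.one_mem_part |>.trans (by
      rw [superSign_zero, one_smul])
    have h2 : r' (σ v) = r' v := hrσ v
    rw [hE, hE, map_smul, h1, h2]
  let h₁ : V.carrier →ₗ[ℂ] V.carrier := (2 : ℂ)⁻¹ • (h₀ - σ ∘ₗ h₀ ∘ₗ σ)
  have h₁_apply : ∀ v, h₁ v = (2 : ℂ)⁻¹ • (h₀ v - σ (h₀ (σ v))) := fun v => rfl
  have hh₁ : ∀ v, R (h₁ v) + h₁ (R v) = v - E v := by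
    intro v
    have e1 := hh₀ v
    have e2 := congrArg σ (hh₀ (σ v))
    rw [map_sub, hσσ, hσE, map_add, hRσ, map_neg] at e2
    have e3 : σ (R (h₀ (σ v))) = -R (σ (h₀ (σ v))) := by rw [hRσ, neg_neg]
    rw [e3, map_neg] at e2
    rw [h₁_apply, h₁_apply, map_smul, map_sub]
    linear_combination (norm := module) (2 : ℂ)⁻¹ • e1 + (2 : ℂ)⁻¹ • e2
  have hσh₁ : ∀ v, h₁ (σ v) = -σ (h₁ v) := fun v => by
    rw [h₁_apply, h₁_apply, map_smul, map_sub, hσσ, hσσ, ← smul_neg, neg_sub]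
  obtain ⟨h, hh⟩ := LinearMap.exists_extend (p := ι.indSubmodule) (j ∘ₗ h₁)
  have hj : ∀ v : V.carrier, h (j v) = j (h₁ v) := fun v => LinearMap.congr_fun hh v
  have hjσ : ∀ v : V.carrier, parityMap G.part (j v) = j (σ v) := parityMap_indIncl ι
  refine ⟨y, φ, h, hφodd, hφ1, hφinv, fun f hf => ?_, fun f hf => ?_, fun f hf => ?_⟩
  · obtain ⟨v, rfl⟩ : ∃ v : V.carrier, j v = f := exists_indIncl ι hf
    rw [hj]
    exact indIncl_mem ι _
  · obtain ⟨v, rfl⟩ : ∃ v : V.carrier, j v = f := exists_indIncl ι hf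
    rw [hjσ, hj, hj, hσh₁, map_neg, hjσ]
  · obtain ⟨v, rfl⟩ : ∃ v : V.carrier, j v = f := exists_indIncl ι hf
    rw [hj, hd, hd, hj, hφr', ← map_add, hh₁, map_sub, hE, map_smul, hju,
      Algebra.algebraMap_eq_smul_one]

/-! ### Equivariant maps modulo negligible maps -/

section Lift

variable {G K : AlgSupergroup} {ι : G.ClosedEmbedding K}

/-- The linear map underlying a morphism of finite-dimensional modules. -/
def linMap {M N : G.RepCat} (f : M ⟶ N) : M.obj.carrier →ₗ[ℂ] N.obj.carrier := f.hom.toLin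

lemma linMap_injective {M N : G.RepCat} {f g : M ⟶ N} (h : linMap f = linMap g) : f = g :=
  ObjectProperty.hom_ext _ (SMod.hom_ext h)

@[simp] lemma linMap_id (M : G.RepCat) : linMap (𝟙 M) = LinearMap.id := rfl

@[simp] lemma linMap_comp {M N P : G.RepCat} (f : M ⟶ N) (g : N ⟶ P) :
    linMap (f ≫ g) = linMap g ∘ₗ linMap f := rfl

@[simp] lemma linMap_sub {M N : G.RepCat} (f g : M ⟶ N) : linMap (f - g) = linMap f - linMap g :=
  rfl

@[simp] lemma linMap_add {M N : G.RepCat} (f g : M ⟶ N) : linMap (f + g) = linMap f + linMap g :=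
  rfl

@[simp] lemma linMap_zero (M N : G.RepCat) : linMap (0 : M ⟶ N) = 0 := rfl

/-- The morphism with a given underlying linear map. -/
def ofLinMap {M N : G.RepCat} (f : M.obj.carrier →ₗ[ℂ] N.obj.carrier)
    (h : ∀ i, ∀ v ∈ M.obj.part i, f v ∈ N.obj.part i)
    (h' : N.obj.coact ∘ₗ f = f.rTensor G.Coord ∘ₗ M.obj.coact) : M ⟶ N :=
  ObjectProperty.homMk ⟨f, h, h'⟩

lemma str_eq {M : G.RepCat} (f : M ⟶ M) : str f = superTrace M.obj.part (linMap f) := rfl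

/-- Modulo negligible maps, every `K`-equivariant map between `G`-modules is `G`-equivariant: the
average of `g ↦ g⁻¹ φ g` is `G`-equivariant, and the difference from `φ` is negligible. -/
theorem ClosedEmbedding.IsProper.exists_lift (hι : ι.IsProper) {M N : G.RepCat}
    (f : ι.res.obj M ⟶ ι.res.obj N) : ∃ f' : M ⟶ N, IsNegligible (f - ι.res.map f') := by
  obtain ⟨y, φ, h, hφodd, hφ1, hφinv, hI, hodd, hhom⟩ := hι.exists_contraction
  have := M.property
  have := N.property
  obtain ⟨n, _, _, ⟨b⟩⟩ := exists_homogeneousBasis M.obj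
  obtain ⟨n', _, _, ⟨b'⟩⟩ := exists_homogeneousBasis N.obj
  let lf : M.obj.carrier →ₗ[ℂ] N.obj.carrier := f.hom.toLin
  let P := LinearMap.toMatrix b.basis b'.basis lf
  have hPeven : ∀ i j, b'.parity i ≠ b.parity j → P i j = 0 :=
    (b.even_iff b' lf).1 f.hom.even
  have hmem : ∀ i j, conjMatrix b b' P i j ∈ ι.indSubmodule := by
    have h1 := ((b.restrict ι).equivariant_iff (b'.restrict ι) lf).1 f.hom.equivariant
    rw [b.coeff_restrict, b'.coeff_restrict] at h1
    exact conjMatrix_mem_indSubmodule b b' ι h1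
  let P' : Matrix n' n ℂ := (conjMatrix b b' P).map φ
  have hP'even : ∀ i j, b'.parity i ≠ b.parity j → P' i j = 0 := fun i j hij => by
    refine hφodd _ ?_
    have h1 := conjMatrix_mem b b' hPeven i j
    have h2 : b'.parity i + b.parity j = 1 := by
      generalize b'.parity i = x at hij
      generalize b.parity j = z at hij
      revert x z; decide
    rwa [h2] at h1
  have hP'equiv := equivariant_of_invariant_functional b b' ι hφodd hφinv hmem
  let f' : M ⟶ N := ofLinMap (Matrix.toLin b.basis b'.basis P')
    ((b.even_iff b' _).2 (by rwa [LinearMap.toMatrix_toLin]))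
    ((b.equivariant_iff b' _).2 (by rwa [LinearMap.toMatrix_toLin]))
  refine ⟨f', fun g => ?_⟩
  let lg : N.obj.carrier →ₗ[ℂ] M.obj.carrier := g.hom.toLin
  let Q := LinearMap.toMatrix b'.basis b.basis lg
  have hQeven : ∀ i j, b.parity i ≠ b'.parity j → Q i j = 0 :=
    (b'.even_iff b lg).1 g.hom.even
  have hQmem : ∀ i j, conjMatrix b' b Q i j ∈ ι.indSubmodule := by
    have h1 := ((b'.restrict ι).equivariant_iff (b.restrict ι) lg).1 g.hom.equivariant
    rw [b.coeff_restrict, b'.coeff_restrict] at h1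
    exact conjMatrix_mem_indSubmodule b' b ι h1
  have hconj : conjMatrix b b' (P - P') = conjMatrix b b' P - scalarMatrix G.Coord P' := by
    rw [conjMatrix_sub, conjMatrix_of_equivariant b b' hP'equiv]
  have key := superTrace_eq_zero b b' y (I := ι.indSubmodule)
    (fun _ hf _ hf' => ι.mul_mem_indSubmodule hf hf') hφ1 hφinv hI hodd hhom (P := P - P')
    (fun i j hij => by rw [Matrix.sub_apply, hPeven i j hij, hP'even i j hij, sub_zero])
    (fun i j => by
      rw [hconj]
      refine Submodule.sub_mem _ (hmem i j) ?_
      change algebraMap ℂ G.Coord _ ∈ _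
      rw [Algebra.algebraMap_eq_smul_one]
      exact Submodule.smul_mem _ _ ι.one_mem_indSubmodule)
    (fun i j => by
      rw [hconj, Matrix.sub_apply, map_sub]
      change _ - φ (algebraMap ℂ G.Coord _) = 0
      rw [Algebra.algebraMap_eq_smul_one, map_smul, hφ1, smul_eq_mul, mul_one]
      exact sub_self _)
    hQeven hQmem
  have htr := (b.restrict ι).superTrace_eq (lg ∘ₗ (lf - linMap f'))
  have hmat : LinearMap.toMatrix b.basis b.basis (lg ∘ₗ (lf - linMap f')) =
      Q * (P - P') := by
    rw [LinearMap.toMatrix_comp b.basis b'.basis b.basis, map_sub]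
    congr 2
    exact LinearMap.toMatrix_toLin _ _ _
  rw [← hmat] at key
  exact htr.trans key

end Lift

end AlgSupergroup

/-! ### Direct sums in preadditive categories -/

section Preadditive

variable {C : Type*} [Category* C] [Preadditive C]

lemma isDirectSum_iff {X Y Z : C} : IsDirectSum X Y Z ↔
    ∃ (i : Y ⟶ X) (p : X ⟶ Y) (j : Z ⟶ X) (q : X ⟶ Z),
      i ≫ p = 𝟙 Y ∧ j ≫ q = 𝟙 Z ∧ i ≫ q = 0 ∧ j ≫ p = 0 ∧ p ≫ i + q ≫ j = 𝟙 X := by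
  constructor
  · rintro ⟨b, ⟨hb⟩, ⟨e⟩⟩
    refine ⟨b.inl ≫ e.hom, e.inv ≫ b.fst, b.inr ≫ e.hom, e.inv ≫ b.snd, by simp, by simp, by simp,
      by simp, ?_⟩
    have h : e.inv ≫ (b.fst ≫ b.inl + b.snd ≫ b.inr) ≫ e.hom = 𝟙 X := by
      rw [Limits.IsBilimit.binary_total hb, Category.id_comp, e.inv_hom_id]
    simpa using h
  · rintro ⟨i, p, j, q, h1, h2, h3, h4, h5⟩
    let b : Limits.BinaryBicone Y Z := ⟨X, p, q, i, j, h1, h3, h4, h2⟩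
    exact ⟨b, ⟨Limits.isBinaryBilimitOfTotal b h5⟩, ⟨Iso.refl X⟩⟩

end Preadditive

namespace AlgSupergroup

variable {G : AlgSupergroup}

/-! ### Supertraces -/

section Supertrace

lemma parityMap_linMap {M N : G.RepCat} (f : M ⟶ N) :
    parityMap N.obj.part ∘ₗ linMap f = linMap f ∘ₗ parityMap M.obj.part :=
  LinearMap.ext fun v => parityMap_comm M.obj.part N.obj.part (linMap f) f.hom.even v

instance (M : G.RepCat) : FiniteDimensional ℂ M.obj.carrier := M.property

lemma str_comp_comm {M N : G.RepCat} (f : M ⟶ N) (g : N ⟶ M) : str (f ≫ g) = str (g ≫ f) := by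
  rw [str_eq, str_eq, superTrace, superTrace, linMap_comp, linMap_comp, ← LinearMap.comp_assoc,
    LinearMap.trace_comp_comm', ← LinearMap.comp_assoc, ← parityMap_linMap, LinearMap.comp_assoc]

lemma str_add {M : G.RepCat} (f g : M ⟶ M) : str (f + g) = str f + str g := by
  simp [str_eq, superTrace, LinearMap.comp_add]

lemma str_sub {M : G.RepCat} (f g : M ⟶ M) : str (f - g) = str f - str g := by
  simp [str_eq, superTrace, LinearMap.comp_sub]

lemma str_zero (M : G.RepCat) : str (0 : M ⟶ M) = 0 := by
  simp [str_eq, superTrace]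

lemma str_id (M : G.RepCat) : str (𝟙 M) = sdim M := by
  have h : ∀ i, LinearMap.trace ℂ M.obj.carrier (superProj M.obj.part i) =
      Module.finrank ℂ (M.obj.part i) := fun i =>
    LinearMap.IsProj.trace ⟨superProj_mem M.obj.part i, fun v hv => by
      rw [superProj_of_mem M.obj.part i hv, if_pos rfl]⟩
  rw [str_eq, superTrace, linMap_id, LinearMap.comp_id, parityMap, map_sub, h, h, sdim]
  push_cast
  rfl

lemma str_eq_zero_of_isNilpotent {M : G.RepCat} (f : M ⟶ M)
    (hf : IsNilpotent (linMap f : Module.End ℂ M.obj.carrier)) : str f = 0 := by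
  have hc : Commute (parityMap M.obj.part : Module.End ℂ M.obj.carrier) (linMap f) :=
    parityMap_linMap f
  have h := hc.isNilpotent_mul_left hf
  exact (LinearMap.isNilpotent_trace_of_isNilpotent h).eq_zero

lemma sdim_eq_add {X Y Z : G.RepCat} (h : IsDirectSum X Y Z) : sdim X = sdim Y + sdim Z := by
  obtain ⟨i, p, j, q, h1, h2, -, -, h5⟩ := isDirectSum_iff.1 h
  have h6 := congrArg str h5
  rw [str_add, str_comp_comm, h1, str_comp_comm, h2, str_id, str_id, str_id] at h6
  exact_mod_cast h6.symm

lemma sdim_eq_zero_of_isZero {X : G.RepCat} (h : Limits.IsZero X) : sdim X = 0 := by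
  have h1 : 𝟙 X = 0 := h.eq_of_src _ _
  have h2 := str_id X
  rw [h1, str_zero] at h2
  exact_mod_cast h2.symm

end Supertrace

/-! ### Submodules, retracts and the Fitting decomposition -/

section Fitting

/-- A stable subspace: a graded subspace which is a subcomodule. -/
structure IsStable (M : G.RepCat) (U : Submodule ℂ M.obj.carrier) : Prop where
  parity : ∀ v ∈ U, parityMap M.obj.part v ∈ U
  coact : IsSubcomodule G.Coord M.obj.coact U

lemma isStable_range {M N : G.RepCat} (f : M ⟶ N) : IsStable N (LinearMap.range (linMap f)) := by
  constructor
  · rintro _ ⟨v, rfl⟩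
    exact ⟨parityMap M.obj.part v, (LinearMap.congr_fun (parityMap_linMap f) v).symm⟩
  · rintro _ ⟨v, rfl⟩
    refine ⟨(linMap f).rangeRestrict.rTensor G.Coord (M.obj.coact v), ?_⟩
    rw [← LinearMap.comp_apply, ← LinearMap.rTensor_comp]
    exact (LinearMap.congr_fun f.hom.equivariant v).symm

lemma isStable_ker {M N : G.RepCat} (f : M ⟶ N) : IsStable M (LinearMap.ker (linMap f)) := by
  constructor
  · intro v hv
    have := LinearMap.congr_fun (parityMap_linMap f) v
    rw [LinearMap.comp_apply, LinearMap.comp_apply, LinearMap.mem_ker.1 hv, map_zero] at this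
    exact this.symm
  · intro v hv
    have hex : Function.Exact (LinearMap.ker (linMap f)).subtype (linMap f) :=
      LinearMap.exact_subtype_ker_map _
    refine (Module.Flat.rTensor_exact G.Coord hex _).1 ?_
    have h := LinearMap.congr_fun f.hom.equivariant v
    refine h.symm.trans ?_
    have hv' : f.hom.toLin v = 0 := hv
    rw [LinearMap.comp_apply, hv', map_zero]

variable {M : G.RepCat} {U U' : Submodule ℂ M.obj.carrier}

/-- The finite-dimensional `G`-module on a stable subspace. -/
def subRep (hU : IsStable M U) : G.RepCat :=
  ⟨M.obj.sub U hU.parity hU.coact,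
    inferInstanceAs (FiniteDimensional ℂ U)⟩

/-- The inclusion of a stable subspace. -/
def subIncl (hU : IsStable M U) : subRep hU ⟶ M :=
  ofLinMap (M := subRep hU) U.subtype (fun _ _ h => h) (by
    ext v
    exact (SMod.rTensor_subCoact M.obj U hU.coact v).symm)

lemma even_of_parityMap_comm {M N : G.RepCat} {f : M.obj.carrier →ₗ[ℂ] N.obj.carrier}
    (h : ∀ v, parityMap N.obj.part (f v) = f (parityMap M.obj.part v)) (i : ZMod 2)
    (v : M.obj.carrier) (hv : v ∈ M.obj.part i) : f v ∈ N.obj.part i := by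
  apply mem_of_parityMap
  rw [h, parityMap_of_mem M.obj.part hv, map_smul]

/-- A map into `M` with image in a stable subspace factors through it. -/
lemma exists_factorization {N : G.RepCat} (hU : IsStable M U) (f : N ⟶ M)
    (hf : ∀ v, linMap f v ∈ U) : ∃ g : N ⟶ subRep hU, g ≫ subIncl hU = f := by
  let g₀ : N.obj.carrier →ₗ[ℂ] U := LinearMap.codRestrict U (linMap f) hf
  refine ⟨ofLinMap (N := subRep hU) g₀ (fun i v hv => f.hom.even i v hv) ?_, linMap_injective ?_⟩
  · ext v
    apply SMod.rTensor_subtype_injective M.obj U G.Coord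
    refine (SMod.rTensor_subCoact M.obj U hU.coact (g₀ v)).trans ?_
    refine (LinearMap.congr_fun f.hom.equivariant v).trans ?_
    change _ = (U.subtype.rTensor G.Coord) (g₀.rTensor G.Coord (N.obj.coact v))
    exact LinearMap.rTensor_comp_apply G.Coord U.subtype g₀ (N.obj.coact v)
  · rfl

/-- The projection onto a stable subspace along a stable complement is equivariant. -/
lemma exists_projection (hU : IsStable M U) (hU' : IsStable M U') (h : IsCompl U U') :
    ∃ e : M ⟶ M, (∀ v, linMap e v ∈ U) ∧ (∀ v ∈ U, linMap e v = v) ∧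
      ∀ v ∈ U', linMap e v = 0 := by
  let e₀ : M.obj.carrier →ₗ[ℂ] M.obj.carrier := U.subtype ∘ₗ Submodule.projectionOnto U U' h
  have h1 : ∀ v ∈ U, e₀ v = v := fun v hv =>
    congrArg Subtype.val (Submodule.projectionOnto_apply_left h ⟨v, hv⟩)
  have h2 : ∀ v ∈ U', e₀ v = 0 := fun v hv => by
    have := (Submodule.projectionOnto_apply_eq_zero_iff h).2 hv
    simp [e₀, this]
  have hdec : ∀ v, ∃ a ∈ U, ∃ c ∈ U', a + c = v := fun v =>
    Submodule.mem_sup.1 (h.sup_eq_top ▸ Submodule.mem_top)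
  refine ⟨ofLinMap e₀ (even_of_parityMap_comm fun v => ?_) (LinearMap.ext fun v => ?_),
    fun v => Subtype.property _, h1, h2⟩
  · obtain ⟨a, ha, c, hc, rfl⟩ := hdec v
    simp only [map_add, h1 a ha, h2 c hc, h1 _ (hU.parity a ha), h2 _ (hU'.parity c hc), map_zero]
  · obtain ⟨a, ha, c, hc, rfl⟩ := hdec v
    have ha' : e₀.rTensor G.Coord (M.obj.coact a) = M.obj.coact a := by
      obtain ⟨t, ht⟩ := hU.coact a ha
      rw [← ht, ← LinearMap.comp_apply, ← LinearMap.rTensor_comp]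
      congr 2
      ext w
      exact h1 w w.2
    have hc' : e₀.rTensor G.Coord (M.obj.coact c) = 0 := by
      obtain ⟨t, ht⟩ := hU'.coact c hc
      rw [← ht, ← LinearMap.comp_apply, ← LinearMap.rTensor_comp]
      have : e₀ ∘ₗ U'.subtype = 0 := by
        ext w
        exact h2 w w.2
      rw [this, LinearMap.rTensor_zero, LinearMap.zero_apply]
    simp only [LinearMap.comp_apply, map_add, h1 a ha, h2 c hc, ha', hc', map_zero]

lemma subIncl_cancel {N : G.RepCat} (hU : IsStable M U) {f g : N ⟶ subRep hU}
    (h : f ≫ subIncl hU = g ≫ subIncl hU) : f = g := by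
  apply linMap_injective
  have := congrArg linMap h
  rw [linMap_comp, linMap_comp] at this
  exact LinearMap.ext fun v => U.injective_subtype (LinearMap.congr_fun this v)

/-- Retracts have complements. -/
lemma exists_complement {V X : G.RepCat} {i : V ⟶ X} {p : X ⟶ V} (h : i ≫ p = 𝟙 V) :
    ∃ (Z : G.RepCat) (j : Z ⟶ X) (q : X ⟶ Z),
      j ≫ q = 𝟙 Z ∧ i ≫ q = 0 ∧ j ≫ p = 0 ∧ p ≫ i + q ≫ j = 𝟙 X := by
  have hst := isStable_ker p
  obtain ⟨q, hq⟩ := exists_factorization hst (𝟙 X - p ≫ i) (fun v => by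
    have := congrArg (fun f => linMap f v)
      (show (𝟙 X - p ≫ i) ≫ p = 0 by simp [Preadditive.sub_comp, h])
    exact this)
  have hjp : subIncl hst ≫ p = 0 := by
    apply linMap_injective
    ext v
    exact v.2
  refine ⟨subRep hst, subIncl hst, q, ?_, ?_, hjp, ?_⟩
  · apply subIncl_cancel
    rw [Category.assoc, hq, Preadditive.comp_sub, Category.comp_id, reassoc_of% hjp,
      Limits.zero_comp, sub_zero, Category.id_comp]
  · apply subIncl_cancel
    rw [Category.assoc, hq, Preadditive.comp_sub, Category.comp_id, reassoc_of% h, sub_self,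
      Limits.zero_comp]
  · rw [hq, add_sub_cancel]

lemma isDirectSummand_iff {V X : G.RepCat} :
    IsDirectSummand V X ↔ ∃ (i : V ⟶ X) (p : X ⟶ V), i ≫ p = 𝟙 V := by
  constructor
  · rintro ⟨Z, hZ⟩
    obtain ⟨i, p, -, -, h, -⟩ := isDirectSum_iff.1 hZ
    exact ⟨i, p, h⟩
  · rintro ⟨i, p, h⟩
    obtain ⟨Z, j, q, h1⟩ := exists_complement h
    exact ⟨Z, isDirectSum_iff.2 ⟨i, p, j, q, h, h1⟩⟩

lemma isDirectSummand_trans {V X Y : G.RepCat} (h : IsDirectSummand V X)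
    (h' : IsDirectSummand X Y) : IsDirectSummand V Y := by
  rw [isDirectSummand_iff] at *
  obtain ⟨i, p, h⟩ := h
  obtain ⟨j, q, h'⟩ := h'
  exact ⟨i ≫ j, q ≫ p, by rw [Category.assoc, reassoc_of% h', h]⟩

/-- A nonzero retract of an indecomposable module is the whole module. -/
lemma retract_eq_id {V X : G.RepCat} (hX : IsIndecomposable X) (hV : ¬ Limits.IsZero V)
    {i : V ⟶ X} {p : X ⟶ V} (h : i ≫ p = 𝟙 V) : p ≫ i = 𝟙 X := by
  obtain ⟨Z, j, q, h1, h2, h3, h4⟩ := exists_complement h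
  have hZ := (hX.2 V Z (isDirectSum_iff.2 ⟨i, p, j, q, h, h1, h2, h3, h4⟩)).resolve_left hV
  rw [hZ.eq_of_tgt q 0, Limits.zero_comp, add_zero] at h4
  exact h4

lemma isIso_of_bijective {N : G.RepCat} (f : M ⟶ N) (h : Function.Bijective (linMap f)) :
    IsIso f := by
  let e := LinearEquiv.ofBijective (linMap f) h
  have h1 : linMap f ∘ₗ e.symm.toLinearMap = LinearMap.id := LinearMap.ext e.apply_symm_apply
  have h2 : e.symm.toLinearMap ∘ₗ linMap f = LinearMap.id := LinearMap.ext e.symm_apply_apply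
  refine ⟨ofLinMap e.symm.toLinearMap (even_of_parityMap_comm fun v => ?_)
    (LinearMap.ext fun v => ?_), linMap_injective h2, linMap_injective h1⟩
  · obtain ⟨w, rfl⟩ := h.2 v
    rw [← LinearMap.comp_apply (parityMap N.obj.part), parityMap_linMap]
    exact (congrArg _ (e.symm_apply_apply w)).trans (e.symm_apply_apply _).symm
  · obtain ⟨w, rfl⟩ := h.2 v
    have h3 := LinearMap.congr_fun f.hom.equivariant w
    have h4 : e.symm.toLinearMap.rTensor G.Coord (N.obj.coact (linMap f w)) =
        e.symm.toLinearMap.rTensor G.Coord ((linMap f).rTensor G.Coord (M.obj.coact w)) :=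
      congrArg _ h3
    rw [← LinearMap.rTensor_comp_apply, h2, LinearMap.rTensor_id_apply] at h4
    exact (congrArg _ (e.symm_apply_apply w)).trans h4.symm

/-- Fitting's lemma. -/
lemma isIso_or_isNilpotent {X : G.RepCat} (hX : IsIndecomposable X) (f : X ⟶ X) :
    IsIso f ∨ IsNilpotent (linMap f : Module.End ℂ X.obj.carrier) := by
  let F : Module.End ℂ X.obj.carrier := linMap f
  have hpow : ∀ n : ℕ, ∃ g : X ⟶ X, linMap g = F ^ n := by
    intro n
    induction n with
    | zero => exact ⟨𝟙 X, rfl⟩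
    | succ n ih =>
      obtain ⟨g, hg⟩ := ih
      exact ⟨f ≫ g, by rw [linMap_comp, hg, pow_succ]; rfl⟩
  obtain ⟨n, hn⟩ := Filter.eventually_atTop.1 (LinearMap.eventually_isCompl_ker_pow_range_pow F)
  have hc := (hn (n + 1) (Nat.le_succ n)).symm
  obtain ⟨g, hg⟩ := hpow (n + 1)
  rw [← hg] at hc
  have hU := isStable_range g
  obtain ⟨e, he1, he2, -⟩ := exists_projection hU (isStable_ker g) hc
  obtain ⟨p, hp⟩ := exists_factorization hU e he1
  have hip : subIncl hU ≫ p = 𝟙 _ := by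
    apply subIncl_cancel
    rw [Category.assoc, hp, Category.id_comp]
    exact linMap_injective (LinearMap.ext fun v => he2 _ v.2)
  by_cases hz : Limits.IsZero (subRep hU)
  · right
    refine ⟨n + 1, LinearMap.ext fun v => ?_⟩
    have h1 : 𝟙 (subRep hU) = 0 := hz.eq_of_src _ _
    have h2 := LinearMap.congr_fun (congrArg linMap h1)
      (⟨linMap g v, v, rfl⟩ : LinearMap.range (linMap g))
    have h3 : linMap g v = 0 := congrArg Subtype.val h2
    rw [hg] at h3
    exact h3
  · left
    have h1 := retract_eq_id hX hz hip
    rw [hp] at h1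
    have hsurj : Function.Surjective (linMap f) := by
      intro v
      have h2 := he1 v
      rw [h1] at h2
      obtain ⟨w, hw⟩ := h2
      rw [hg, pow_succ'] at hw
      exact ⟨(F ^ n) w, hw⟩
    exact isIso_of_bijective f ⟨LinearMap.injective_iff_surjective.2 hsurj, hsurj⟩

lemma isIso_of_str_ne_zero {X : G.RepCat} (hX : IsIndecomposable X) {f : X ⟶ X}
    (hf : str f ≠ 0) : IsIso f :=
  (isIso_or_isNilpotent hX f).resolve_right fun h => hf (str_eq_zero_of_isNilpotent f h)

/-- If a composition `X ⟶ Y ⟶ X` of maps between indecomposable modules has nonzero supertrace,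
then `X` and `Y` are isomorphic. -/
lemma nonempty_iso_of_str_ne_zero {X Y : G.RepCat} (hX : IsIndecomposable X)
    (hY : IsIndecomposable Y) (f : X ⟶ Y) (g : Y ⟶ X) (h : str (f ≫ g) ≠ 0) :
    Nonempty (X ≅ Y) := by
  have := isIso_of_str_ne_zero hX h
  have h1 : f ≫ g ≫ inv (f ≫ g) = 𝟙 X := by rw [← Category.assoc, IsIso.hom_inv_id]
  exact ⟨⟨f, g ≫ inv (f ≫ g), h1, retract_eq_id hY hX.1 h1⟩⟩

/-- Endomorphisms of an indecomposable module are scalar modulo negligible ones: subtracting an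
eigenvalue leaves an endomorphism which is not invertible, and so are all its multiples. -/
lemma exists_scalar {X : G.RepCat} (hX : IsIndecomposable X) (f : X ⟶ X) :
    ∃ (c : ℂ), ∀ g : X ⟶ X, str (f ≫ g) = c * str g := by
  have hnt : Nontrivial X.obj.carrier := by
    by_contra hn
    rw [not_nontrivial_iff_subsingleton] at hn
    apply hX.1
    rw [Limits.IsZero.iff_id_eq_zero]
    exact linMap_injective (LinearMap.ext fun v => Subsingleton.elim _ _)
  obtain ⟨c, hc⟩ := Module.End.exists_eigenvalue (linMap f : Module.End ℂ X.obj.carrier)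
  obtain ⟨v, hv⟩ := hc.exists_hasEigenvector
  refine ⟨c, fun g => ?_⟩
  have hscal : ∃ s : X ⟶ X, linMap s = c • LinearMap.id := by
    refine ⟨ofLinMap (c • LinearMap.id) (fun i v hv => Submodule.smul_mem _ _ hv) ?_, rfl⟩
    rw [LinearMap.rTensor_smul, LinearMap.rTensor_id, LinearMap.comp_smul]
    rfl
  obtain ⟨s, hs⟩ := hscal
  have h1 : str (s ≫ g) = c * str g := by
    rw [str_eq, str_eq, superTrace, superTrace, linMap_comp, hs, LinearMap.comp_smul,
      LinearMap.comp_id, LinearMap.comp_smul, map_smul, smul_eq_mul]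
  have h2 : str ((f - s) ≫ g) = 0 := by
    by_contra h
    have := isIso_of_str_ne_zero hX h
    have h3 := congrArg (fun k => linMap k v) (IsIso.hom_inv_id ((f - s) ≫ g))
    have h4 : linMap (f - s) v = 0 := by
      rw [linMap_sub, hs, LinearMap.sub_apply, hv.apply_eq_smul]
      simp
    simp only [linMap_comp, LinearMap.comp_apply, h4, map_zero, linMap_id,
      LinearMap.id_apply] at h3
    exact hv.2 h3.symm
  rw [Preadditive.sub_comp, str_sub, h1] at h2
  exact sub_eq_zero.1 h2

/-- A module of nonzero superdimension has an indecomposable direct summand of nonzero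
superdimension. -/
lemma exists_indecNonzero (X : G.RepCat) (hX : sdim X ≠ 0) :
    ∃ V : G.IndecNonzero, IsDirectSummand V.1 X := by
  induction hn : Module.finrank ℂ X.obj.carrier using Nat.strong_induction_on generalizing X with
  | _ n ih =>
    by_cases hind : IsIndecomposable X
    · exact ⟨⟨X, hind, hX⟩, isDirectSummand_iff.2 ⟨𝟙 X, 𝟙 X, Category.comp_id _⟩⟩
    · have hnz : ¬ Limits.IsZero X := fun h => hX (sdim_eq_zero_of_isZero h)
      have hlt : ∀ {Y Z : G.RepCat} {i : Y ⟶ X} {p : X ⟶ Y} {j : Z ⟶ X} {q : X ⟶ Z},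
          i ≫ p = 𝟙 Y → j ≫ q = 𝟙 Z → j ≫ p = 0 → ¬ Limits.IsZero Z →
          Module.finrank ℂ Y.obj.carrier < Module.finrank ℂ X.obj.carrier := by
        intro Y Z i p j q hip hjq hjp hZ
        have hinj : Function.Injective (linMap i) :=
          Function.LeftInverse.injective (g := linMap p) fun v =>
            LinearMap.congr_fun (congrArg linMap hip) v
        refine lt_of_le_of_ne (LinearMap.finrank_le_finrank_of_injective hinj) fun heq => hZ ?_
        have hpsurj : Function.Surjective (linMap p) := fun v =>
          ⟨linMap i v, LinearMap.congr_fun (congrArg linMap hip) v⟩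
        have hpinj : Function.Injective (linMap p) :=
          (LinearMap.injective_iff_surjective_of_finrank_eq_finrank heq.symm).2 hpsurj
        have hj0 : j = 0 := linMap_injective (LinearMap.ext fun v => hpinj (by
          have := LinearMap.congr_fun (congrArg linMap hjp) v
          refine this.trans ?_
          simp))
        rw [Limits.IsZero.iff_id_eq_zero, ← hjq, hj0, Limits.zero_comp]
      obtain ⟨Y, Z, hYZ, hY, hZ⟩ : ∃ Y Z, IsDirectSum X Y Z ∧ ¬ Limits.IsZero Y ∧
          ¬ Limits.IsZero Z := by
        by_contra hcon
        push Not at hcon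
        exact hind ⟨hnz, fun Y Z h => or_iff_not_imp_left.2 (hcon Y Z h)⟩
      have hs := sdim_eq_add hYZ
      obtain ⟨i, p, j, q, h1, h2, h3, h4, h5⟩ := isDirectSum_iff.1 hYZ
      by_cases hYs : sdim Y = 0
      · have hZs : sdim Z ≠ 0 := fun h => hX (by rw [hs, hYs, h, add_zero])
        obtain ⟨V, hV⟩ := ih _ (hn ▸ hlt h2 h1 h3 hY) Z hZs rfl
        exact ⟨V, isDirectSummand_trans hV (isDirectSummand_iff.2 ⟨j, q, h2⟩)⟩
      · obtain ⟨V, hV⟩ := ih _ (hn ▸ hlt h1 h2 h4 hZ) Y hYs rfl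
        exact ⟨V, isDirectSummand_trans hV (isDirectSummand_iff.2 ⟨i, p, h1⟩)⟩

end Fitting

/-! ### Restriction of indecomposable modules -/

section Main

variable {G K : AlgSupergroup} {ι : G.ClosedEmbedding K}

lemma IsNegligible.str_comp {M N : G.RepCat} {f f' : M ⟶ N} (h : IsNegligible (f - f'))
    (g : N ⟶ M) : str (f ≫ g) = str (f' ≫ g) := by
  have := h g
  rw [Preadditive.sub_comp, str_sub] at this
  exact sub_eq_zero.1 this

lemma str_res {M : G.RepCat} (f : M ⟶ M) : str (ι.res.map f) = str f := rfl

namespace ClosedEmbedding.IsProper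

/-- Restriction preserves negligible maps. -/
lemma isNegligible_res (hι : ι.IsProper) {M N : G.RepCat} {f : M ⟶ N} (hf : IsNegligible f) :
    IsNegligible (ι.res.map f) := by
  intro g
  obtain ⟨g', hg⟩ := hι.exists_lift g
  rw [str_comp_comm, hg.str_comp, ← Functor.map_comp, str_res, str_comp_comm, hf]

/-- Modulo negligible maps, the `K`-endomorphisms of an indecomposable `G`-module are scalars. -/
lemma exists_scalar_res (hι : ι.IsProper) {M : G.RepCat} (hM : IsIndecomposable M)
    (f : ι.res.obj M ⟶ ι.res.obj M) :
    ∃ c : ℂ, ∀ g : ι.res.obj M ⟶ ι.res.obj M, str (f ≫ g) = c * str g := by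
  obtain ⟨f', hf⟩ := hι.exists_lift f
  obtain ⟨c, hc⟩ := exists_scalar hM f'
  refine ⟨c, fun g => ?_⟩
  obtain ⟨g', hg⟩ := hι.exists_lift g
  have h1 : str g = str g' := by
    have := hg.str_comp (𝟙 _)
    rwa [Category.comp_id, Category.comp_id, str_res] at this
  rw [hf.str_comp, str_comp_comm, hg.str_comp, ← Functor.map_comp, str_res, str_comp_comm, hc, h1]

/-- Two retracts of nonzero superdimension of the restriction of an indecomposable module cannot
be orthogonal: modulo negligible maps, their idempotents are nonzero scalars. -/
lemma str_idempotents_ne_zero (hι : ι.IsProper) {M : G.RepCat} (hM : IsIndecomposable M)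
    {V V' : K.RepCat} (hV : sdim V ≠ 0) (hV' : sdim V' ≠ 0)
    {i : V ⟶ ι.res.obj M} {p : ι.res.obj M ⟶ V}
    {j : V' ⟶ ι.res.obj M} {q : ι.res.obj M ⟶ V'} (h : i ≫ p = 𝟙 V) (h' : j ≫ q = 𝟙 V') :
    str ((p ≫ i) ≫ q ≫ j) ≠ 0 := by
  obtain ⟨c, hc⟩ := hι.exists_scalar_res hM (p ≫ i)
  rw [hc, str_comp_comm q j, h', str_id]
  have h1 := hc (𝟙 _)
  rw [Category.comp_id, str_comp_comm, h, str_id] at h1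
  refine mul_ne_zero (fun h0 => hV ?_) (by exact_mod_cast hV')
  rw [h0, zero_mul] at h1
  exact_mod_cast h1

/-- Up to isomorphism, the restriction of an indecomposable `G`-module has at most one
indecomposable summand of nonzero superdimension. -/
lemma nonempty_iso_of_summands (hι : ι.IsProper) {M : G.RepCat} (hM : IsIndecomposable M)
    {V V' : K.IndecNonzero} (h : IsDirectSummand V.1 (ι.res.obj M))
    (h' : IsDirectSummand V'.1 (ι.res.obj M)) :
    Nonempty (V.1 ≅ V'.1) := by
  rw [isDirectSummand_iff] at h h'
  obtain ⟨i, p, h⟩ := h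
  obtain ⟨j, q, h'⟩ := h'
  refine nonempty_iso_of_str_ne_zero V.2.1 V'.2.1 (i ≫ q) (j ≫ p) ?_
  have h1 := hι.str_idempotents_ne_zero hM V.2.2 V'.2.2 h h'
  rw [Category.assoc, str_comp_comm] at h1
  simpa only [Category.assoc] using h1

/-- Indecomposable `G`-modules whose restrictions share a summand of nonzero superdimension are
isomorphic: the maps through the summand lift to `G`-maps whose composition has nonzero
supertrace. -/
lemma nonempty_iso_of_common_summand (hι : ι.IsProper) {M N : G.RepCat} (hM : IsIndecomposable M)
    (hN : IsIndecomposable N) {V : K.RepCat} (hV : sdim V ≠ 0)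
    (h : IsDirectSummand V (ι.res.obj M)) (h' : IsDirectSummand V (ι.res.obj N)) :
    Nonempty (M ≅ N) := by
  rw [isDirectSummand_iff] at h h'
  obtain ⟨i, p, h⟩ := h
  obtain ⟨j, q, h'⟩ := h'
  obtain ⟨f, hf⟩ := hι.exists_lift (p ≫ j)
  obtain ⟨g, hg⟩ := hι.exists_lift (q ≫ i)
  refine nonempty_iso_of_str_ne_zero hM hN f g ?_
  have h1 : str ((p ≫ j) ≫ q ≫ i) = str (f ≫ g) := by
    rw [hf.str_comp, str_comp_comm, hg.str_comp, ← Functor.map_comp, str_res, str_comp_comm]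
  rw [← h1, Category.assoc, reassoc_of% h', str_comp_comm, h, str_id]
  exact_mod_cast hV

end ClosedEmbedding.IsProper

end Main

end AlgSupergroup

theorem mainTheorem1 (G K : AlgSupergroup) (ι : G.ClosedEmbedding K) (hι : ι.IsProper) :
    (∃! F : G.Semisimplification ⥤ K.Semisimplification,
      G.semisimplify ⋙ F = ι.res ⋙ K.semisimplify) ∧
    (∀ F : G.Semisimplification ⥤ K.Semisimplification,
      G.semisimplify ⋙ F = ι.res ⋙ K.semisimplify → F.Full) ∧
    (∃ Φ : G.IndecClass → K.IndecClass, Function.Injective Φ ∧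
      ∀ (M : G.IndecNonzero) (V : K.IndecNonzero),
        Φ (AlgSupergroup.isoClass M) = AlgSupergroup.isoClass V ↔
          IsDirectSummand V.1 (ι.res.obj M.1)) ∧
    (∀ (M : G.IndecNonzero) (V : K.IndecNonzero) (W : K.RepCat),
      IsDirectSum (ι.res.obj M.1) V.1 W →
        ∀ V' : K.IndecNonzero, ¬ IsDirectSummand V'.1 W) := by
  have hlift : ∀ (M N : G.RepCat) (f f' : M ⟶ N), G.negligibleRel f f' →
      (ι.res ⋙ K.semisimplify).map f = (ι.res ⋙ K.semisimplify).map f' := by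
    intro M N f f' h
    apply CategoryTheory.Quotient.sound
    have := hι.isNegligible_res h
    rwa [show ι.res.map (f - f') = ι.res.map f - ι.res.map f' from rfl] at this
  let F₀ := CategoryTheory.Quotient.lift G.negligibleRel (ι.res ⋙ K.semisimplify) hlift
  have huniq : ∀ F : G.Semisimplification ⥤ K.Semisimplification,
      G.semisimplify ⋙ F = ι.res ⋙ K.semisimplify → F = F₀ := fun F hF =>
    CategoryTheory.Quotient.lift_unique G.negligibleRel _ hlift F hF
  refine ⟨⟨F₀, CategoryTheory.Quotient.lift_spec _ _ hlift, huniq⟩, fun F hF => ?_, ?_, ?_⟩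
  · rw [huniq F hF]
    refine ⟨fun {X Y} g => ?_⟩
    obtain ⟨g', hg'⟩ := K.semisimplify.map_surjective g
    obtain ⟨f, hf⟩ := hι.exists_lift (M := X.as) (N := Y.as) g'
    refine ⟨G.semisimplify.map f, ?_⟩
    rw [← hg']
    exact (CategoryTheory.Quotient.sound _ hf).symm
  · choose S hS using fun M : G.IndecNonzero =>
      AlgSupergroup.exists_indecNonzero (ι.res.obj M.1) M.2.2
    have hiso : ∀ {M N : G.IndecNonzero} {V : K.IndecNonzero}, Nonempty (M.1 ≅ N.1) →
        IsDirectSummand V.1 (ι.res.obj N.1) → IsDirectSummand V.1 (ι.res.obj M.1) := by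
      rintro M N V ⟨e⟩ h
      exact AlgSupergroup.isDirectSummand_trans h (AlgSupergroup.isDirectSummand_iff.2
        ⟨ι.res.map e.inv, ι.res.map e.hom, (ι.res.mapIso e).inv_hom_id⟩)
    let Φ : G.IndecClass → K.IndecClass := _root_.Quotient.lift
      (fun M => AlgSupergroup.isoClass (S M)) (fun M N hMN => _root_.Quotient.sound
        (hι.nonempty_iso_of_summands M.2.1 (hS M) (hiso hMN (hS N))))
    refine ⟨Φ, ?_, ?_⟩
    · intro a b
      induction a using _root_.Quotient.inductionOn with | _ M
      induction b using _root_.Quotient.inductionOn with | _ N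
      intro h
      obtain ⟨e⟩ : Nonempty ((S M).1 ≅ (S N).1) := _root_.Quotient.exact h
      refine _root_.Quotient.sound
        (hι.nonempty_iso_of_common_summand M.2.1 N.2.1 (S N).2.2 ?_ (hS N))
      exact AlgSupergroup.isDirectSummand_trans
        (AlgSupergroup.isDirectSummand_iff.2 ⟨e.inv, e.hom, e.inv_hom_id⟩) (hS M)
    · intro M V
      constructor
      · intro h
        obtain ⟨e⟩ : Nonempty ((S M).1 ≅ V.1) := _root_.Quotient.exact h
        exact AlgSupergroup.isDirectSummand_trans
          (AlgSupergroup.isDirectSummand_iff.2 ⟨e.inv, e.hom, e.inv_hom_id⟩) (hS M)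
      · intro h
        exact _root_.Quotient.sound (hι.nonempty_iso_of_summands M.2.1 (hS M) h)
  · intro M V W hW V' hV'
    obtain ⟨i, p, j, q, h1, h2, h3, h4, -⟩ := isDirectSum_iff.1 hW
    obtain ⟨i', p', h'⟩ := AlgSupergroup.isDirectSummand_iff.1 hV'
    refine hι.str_idempotents_ne_zero M.2.1 V.2.2 V'.2.2 h1 (j := i' ≫ j) (q := q ≫ p') ?_ ?_
    · rw [Category.assoc, reassoc_of% h2, h']
    · rw [Category.assoc, Category.assoc, reassoc_of% h3, Limits.zero_comp, Limits.comp_zero,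
        AlgSupergroup.str_zero]

end
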